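/- **Setting.** Let $\Omega=(t_0,t_f)\subset\mathbb R$ be a bounded interval with $t_0<t_f$, let $\{\nu_1,\dots,\nu_M\}\subset\mathbb Z$ be finite, and let $\alpha>0$. For $u\in L^1(\Omega)$ let $\mathrm{TV}(u)=\sup\{\int_\Omega u\,\phi'\,dx : \phi\in C^1_c(\Omega),\ \sup|\phi|\le 1\}\in[0,\infty]$, and $BV(\Omega)=\{u\in L^1(\Omega):\mathrm{TV}(u)<\infty\}$. Call $v\in L^2(\Omega)$ *feasible* if $v(x)\in\{\nu_1,\dots,\nu_M\}$ for a.a. $x\in\Omega$, and let $J(v)=F(v)+\alpha\,\mathrm{TV}(v)$. Assume that $F:L^2(\Omega)\to\mathbb R$ is lower semicontinuous, bounded below and twice continuously Fréchet differentiable, and that for some $C>0$ $$|\nabla^2F(\xi)(u,w)|\le C\,\|u\|_{L^1(\Omega)}\|w\|_{L^1(\Omega)}\qquad\text{for all }\xi,u,w\in L^2(\Omega).$$ **Trust-region subproblem.** For a feasible $c\in BV(\Omega)$, $g\in L^2(\Omega)$ and $\Delta>0$, $\mathrm{TR}(c,g,\Delta)$ is the problem of minimizing $(g,w-c)_{L^2(\Omega)}+\alpha\,\mathrm{TV}(w)-\alpha\,\mathrm{TV}(c)$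 over all feasible $w\in L^2(\Omega)$ with $\|w-c\|_{L^1(\Omega)}\le\Delta$. **L-stationarity.** A feasible $v\in BV(\Omega)$ can be written as $v=a_i$ a.e. on $(t_{i-1},t_i)$, $i=1,\dots,N$, with $t_0<t_1<\dots<t_N=t_f$, $a_i\in\{\nu_1,\dots,\nu_M\}$ and $a_i\ne a_{i+1}$. With $g=\nabla F(v)$ let $\overline{D}{}_i^+,\underline{D}{}_i^+$ be the $\limsup$ and $\liminf$ (in $[-\infty,\infty]$) of $\frac1h\int_{t_i}^{t_i+h}g$ as $h\downarrow0$, and $\overline{D}{}_i^-,\underline{D}{}_i^-$ those of $\frac1h\int_{t_i-h}^{t_i}g$. Then $v$ is *L-stationary* if for every $i\in\{1,\dots,N-1\}$: $\overline{D}{}_i^-\ge0\ge\underline{D}{}_i^+$ if $a_i<a_{i+1}$, and $\underline{D}{}_i^-\le0\le\overline{D}{}_i^+$ if $a_{i+1}<a_i$. **Algorithm (SLIP).** Inputs: $\Delta^0>0$, $\sigma\in(0,1)$ and a feasible $v^0\in BV(\Omega)$. For $n=1,2,\dots$ set $k=0$, $\Delta^{n,0}=\Delta^0$ and repeat the following inner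 loop. Let $\bar v^{n,k}$ be some minimizer of $\mathrm{TR}(v^{n-1},\nabla F(v^{n-1}),\Delta^{n,k})$, let $$\mathrm{pred}=(\nabla F(v^{n-1}),v^{n-1}-\bar v^{n,k})_{L^2(\Omega)}+\alpha\,\mathrm{TV}(v^{n-1})-\alpha\,\mathrm{TV}(\bar v^{n,k}),\qquad \mathrm{ared}=J(v^{n-1})-J(\bar v^{n,k}).$$ If $\mathrm{pred}\le0$, the algorithm terminates, with final iterate $v^{n-1}$. Otherwise, if $\mathrm{ared}<\sigma\,\mathrm{pred}$, set $\Delta^{n,k+1}=\Delta^{n,k}/2$, increase $k$ by one and continue the inner loop. Otherwise set $v^n=\bar v^{n,k}$, leave the inner loop and go on with the next $n$. **Convergence.** $u^n\rightharpoonup^* u$ in $BV(\Omega)$ means $u^n\to u$ in $L^1(\Omega)$ and $\int_\Omega\varphi\,dDu^n\to\int_\Omega\varphi\,dDu$ for all $\varphi\in C_0(\Omega)$, where $Du$ is the derivative measure of $u$. A weak-$^*$ accumulation point is a weak-$^*$ limit of a subsequence. $u^n\to u$ *strictly* means $u^n\to u$ in $L^1(\Omega)$ and $\mathrm{TV}(u^n)\to\mathrm{TV}(u)<\infty$.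 **Theorem 4.13.** Let the iterates $(v^n)_n$ be produced by the algorithm. Then all iterates are feasible and the sequence of objective values $(J(v^n))_n$ is (strictly) decreasing. Moreover, exactly one of the following three outcomes holds. 1. The sequence $(v^n)_n$ is finite, its final element $v^N$ solves $\mathrm{TR}(v^N,\nabla F(v^N),\Delta)$ for some $\Delta>0$, and $v^N$ is L-stationary. (This outcome holds if and only if the algorithm terminates.) 2. The sequence $(v^n)_n$ is finite, and the inner loop does not terminate for its final element $v^N$, which is L-stationary. 3. The sequence $(v^n)_n$ is infinite and has a weak-$^*$ accumulation point in $BV(\Omega)$. Every weak-$^*$ accumulation point of $(v^n)_n$ is feasible and L-stationary, and every subsequence that converges to it weakly-$^*$ converges to it strictly. If $(v^{n_\ell})_\ell$ is a subsequence with $\liminf_{\ell\to\infty}\min_k\Delta^{n_\ell+1,k}>0$, the minimum being over the inner iterations executed in outer iteration $n_\ell+1$, and $\bar v$ is a weak-$^*$ accumulation point of $(v^{n_\ell})_\ell$, then $\bar v$ solves $\mathrm{TR}(\bar v,\nabla F(\bar v),\bar\Delta)$ for some $\bar\Delta>0$. -/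

import Mathlib

open Set Filter Topology MeasureTheory
open scoped ENNReal

namespace SLIP

noncomputable section

/-- The Hilbert space `L²(Ω)` of the interval `Ω = (t₀, t_f)`, with Lebesgue measure. -/
abbrev L2 (t₀ tf : ℝ) : Type := Lp ℝ 2 (volume.restrict (Ioo t₀ tf))

/-- The `L¹(Ω)`-norm of a function in `L²(Ω)` (it is finite because `Ω` is bounded). -/
def l1norm {t₀ tf : ℝ} (u : L2 t₀ tf) : ℝ := ∫ x in Ioo t₀ tf, |u x|

/-- `C¹_c(Ω)`: continuously differentiable functions with compact support contained in
`Ω = (t₀, t_f)`, extended by zero to the real line. -/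
def IsTestFun (t₀ tf : ℝ) (φ : ℝ → ℝ) : Prop :=
  ContDiff ℝ 1 φ ∧ HasCompactSupport φ ∧ tsupport φ ⊆ Ioo t₀ tf

/-- The total variation `TV(u) ∈ [0, ∞]`: the supremum of `∫_Ω u φ'` over all `φ ∈ C¹_c(Ω)` with
`sup |φ| ≤ 1`. (Cutting the integral off at `0` is harmless since `φ = 0` is allowed.) -/
def TV {t₀ tf : ℝ} (u : L2 t₀ tf) : ℝ≥0∞ :=
  ⨆ (φ : ℝ → ℝ) (_ : IsTestFun t₀ tf φ ∧ ∀ x, |φ x| ≤ 1),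
    ENNReal.ofReal (∫ x in Ioo t₀ tf, u x * deriv φ x)

/-- Membership in `BV(Ω)`. In dimension one `BV(Ω) ⊆ L^∞(Ω) ⊆ L²(Ω)`, so nothing is lost by
considering only elements of `L²(Ω)`. -/
def IsBV {t₀ tf : ℝ} (u : L2 t₀ tf) : Prop := TV u < ⊤

/-- The signed measure `μ` is the distributional derivative `Du` on `Ω` (only the part of `μ`
inside `Ω` matters, here and below). -/
def HasDerivMeasure {t₀ tf : ℝ} (u : L2 t₀ tf) (μ : SignedMeasure ℝ) : Prop :=
  ∀ φ : ℝ → ℝ, IsTestFun t₀ tf φ →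
    ∫ x in Ioo t₀ tf, u x * deriv φ x = -∫ᵛ x, φ x ∂•μ

/-- Weak-* convergence `uⁿ ⇀* u` in `BV(Ω)`: `uⁿ → u` in `L¹(Ω)`, and the derivative measures
converge weakly-*, i.e. `∫ φ dDuⁿ → ∫ φ dDu` for all `φ ∈ C₀(Ω)`. Elements of `C₀(Ω)`, extended by
zero, are the continuous functions on the real line that vanish outside `Ω`. -/
def WeakStarTendsto {t₀ tf : ℝ} (u : ℕ → L2 t₀ tf) (v : L2 t₀ tf) : Prop :=
  Tendsto (fun n => l1norm (u n - v)) atTop (𝓝 0) ∧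
  ∃ (μ : ℕ → SignedMeasure ℝ) (μ' : SignedMeasure ℝ),
    (∀ n, HasDerivMeasure (u n) (μ n)) ∧ HasDerivMeasure v μ' ∧
    ∀ φ : ℝ → ℝ, Continuous φ → (∀ x, x ∉ Ioo t₀ tf → φ x = 0) →
      Tendsto (fun n => ∫ᵛ x, φ x ∂•(μ n)) atTop (𝓝 (∫ᵛ x, φ x ∂•μ'))

/-- Strict convergence in `BV(Ω)`: convergence in `L¹(Ω)` and convergence of the finite total
variations. -/
def StrictTendsto {t₀ tf : ℝ} (u : ℕ → L2 t₀ tf) (v : L2 t₀ tf) : Prop :=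
  IsBV v ∧ Tendsto (fun n => l1norm (u n - v)) atTop (𝓝 0) ∧
  Tendsto (fun n => TV (u n)) atTop (𝓝 (TV v))

/-- Feasibility: `v(x)` lies in the finite set `V = {ν₁, …, ν_M}` of integers for a.a. `x ∈ Ω`. -/
def Feasible {t₀ tf : ℝ} (V : Finset ℤ) (v : L2 t₀ tf) : Prop :=
  ∀ᵐ x ∂(volume.restrict (Ioo t₀ tf)), ∃ ν ∈ V, v x = (ν : ℝ)

/-- The objective `J(v) = F(v) + α TV(v)`. -/
def J {t₀ tf : ℝ} (F : L2 t₀ tf → ℝ) (α : ℝ) (v : L2 t₀ tf) : EReal :=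
  (F v : EReal) + (α : EReal) * (TV v : EReal)

/-! ### The trust-region subproblem `TR(c, g, Δ)` -/

/-- Feasible points of `TR(c, g, Δ)`. -/
def TRFeasible {t₀ tf : ℝ} (V : Finset ℤ) (c : L2 t₀ tf) (Δ : ℝ) (w : L2 t₀ tf) : Prop :=
  Feasible V w ∧ l1norm (w - c) ≤ Δ

/-- Objective of `TR(c, g, Δ)`: `(g, w - c) + α TV(w) - α TV(c)`; it is used for `c ∈ BV(Ω)`. -/
def trObjective {t₀ tf : ℝ} (α : ℝ) (c g w : L2 t₀ tf) : EReal :=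
  ((inner ℝ g (w - c) : ℝ) : EReal) + (α : EReal) * (TV w : EReal) - (α : EReal) * (TV c : EReal)

/-- `w` solves `TR(c, g, Δ)`. -/
def SolvesTR {t₀ tf : ℝ} (V : Finset ℤ) (α : ℝ) (c g : L2 t₀ tf) (Δ : ℝ) (w : L2 t₀ tf) : Prop :=
  TRFeasible V c Δ w ∧ ∀ z, TRFeasible V c Δ z → trObjective α c g w ≤ trObjective α c g z

/-! ### L-stationarity -/

/-- The step function `∑ᵢ aᵢ χ_{[tᵢ, tᵢ₊₁)}` with `m + 1` pieces. -/
def stepFun {m : ℕ} (t : Fin (m + 2) → ℝ) (a : Fin (m + 1) → ℤ) (x : ℝ) : ℝ :=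
  ∑ i : Fin (m + 1), (Ico (t i.castSucc) (t i.succ)).indicator (fun _ => (a i : ℝ)) x

/-- `v = v^{t,a}` with `t₀ < t₁ < ⋯ < t_{m+1} = t_f`, values in `V`, and a genuine jump at each of
the `m` switching locations. -/
def IsStepRep {t₀ tf : ℝ} (V : Finset ℤ) (v : L2 t₀ tf) {m : ℕ} (t : Fin (m + 2) → ℝ)
    (a : Fin (m + 1) → ℤ) : Prop :=
  StrictMono t ∧ t 0 = t₀ ∧ t (Fin.last (m + 1)) = tf ∧ (∀ i, a i ∈ V) ∧
  (∀ i : Fin m, a i.castSucc ≠ a i.succ) ∧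
  v =ᵐ[volume.restrict (Ioo t₀ tf)] stepFun t a

/-- The mean of `g` over `(s, s + h)`. -/
def meanRight {t₀ tf : ℝ} (g : L2 t₀ tf) (s h : ℝ) : EReal :=
  ((h⁻¹ * ∫ x in s..(s + h), g x : ℝ) : EReal)

/-- The mean of `g` over `(s - h, s)`. -/
def meanLeft {t₀ tf : ℝ} (g : L2 t₀ tf) (s h : ℝ) : EReal :=
  ((h⁻¹ * ∫ x in (s - h)..s, g x : ℝ) : EReal)

/-- Upper right Dini derivative of `τ ↦ ∫_s^τ g` at `s`, with values in `[-∞, ∞]`. -/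
def diniUpperRight {t₀ tf : ℝ} (g : L2 t₀ tf) (s : ℝ) : EReal := limsup (meanRight g s) (𝓝[>] 0)

/-- Upper left Dini derivative of `τ ↦ ∫_s^τ g` at `s`. -/
def diniUpperLeft {t₀ tf : ℝ} (g : L2 t₀ tf) (s : ℝ) : EReal := limsup (meanLeft g s) (𝓝[>] 0)

/-- Lower right Dini derivative of `τ ↦ ∫_s^τ g` at `s`. -/
def diniLowerRight {t₀ tf : ℝ} (g : L2 t₀ tf) (s : ℝ) : EReal := liminf (meanRight g s) (𝓝[>] 0)

/-- Lower left Dini derivative of `τ ↦ ∫_s^τ g` at `s`. -/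
def diniLowerLeft {t₀ tf : ℝ} (g : L2 t₀ tf) (s : ℝ) : EReal := liminf (meanLeft g s) (𝓝[>] 0)

/-- L-stationarity of `v` (feasible, in `BV(Ω)`, with its step representation): sign conditions on
the Dini derivatives of `∇F(v)` at every switching location `t (i+1)`, `i < m`, where the value
jumps from `a i` to `a (i+1)`. -/
def LStationary {t₀ tf : ℝ} (F : L2 t₀ tf → ℝ) (V : Finset ℤ) (v : L2 t₀ tf) : Prop :=
  Feasible V v ∧ IsBV v ∧
  ∃ (m : ℕ) (t : Fin (m + 2) → ℝ) (a : Fin (m + 1) → ℤ), IsStepRep V v t a ∧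
    ∀ i : Fin m,
      (a i.castSucc < a i.succ →
        0 ≤ diniUpperLeft (gradient F v) (t i.succ.castSucc) ∧
        diniLowerRight (gradient F v) (t i.succ.castSucc) ≤ 0) ∧
      (a i.succ < a i.castSucc →
        diniLowerLeft (gradient F v) (t i.succ.castSucc) ≤ 0 ∧
        0 ≤ diniUpperRight (gradient F v) (t i.succ.castSucc))

/-! ### The algorithm -/

/-- Predicted reduction: the negative of the subproblem objective at the candidate `w`. -/
def pred {t₀ tf : ℝ} (F : L2 t₀ tf → ℝ) (α : ℝ) (c w : L2 t₀ tf) : EReal :=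
  ((inner ℝ (gradient F c) (c - w) : ℝ) : EReal)
    + (α : EReal) * (TV c : EReal) - (α : EReal) * (TV w : EReal)

/-- Actual reduction. -/
def ared {t₀ tf : ℝ} (F : L2 t₀ tf → ℝ) (α : ℝ) (c w : L2 t₀ tf) : EReal :=
  J F α c - J F α w

/-- The test on the candidate `w` at the iterate `c` stops the whole algorithm. -/
def Stops {t₀ tf : ℝ} (F : L2 t₀ tf → ℝ) (α : ℝ) (c w : L2 t₀ tf) : Prop :=
  pred F α c w ≤ 0

/-- The candidate is rejected; the radius is halved and the inner loop goes on. -/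
def Rejects {t₀ tf : ℝ} (F : L2 t₀ tf → ℝ) (α σ : ℝ) (c w : L2 t₀ tf) : Prop :=
  0 < pred F α c w ∧ ared F α c w < (σ : EReal) * pred F α c w

/-- The candidate is accepted as the next iterate; the inner loop ends. -/
def Accepts {t₀ tf : ℝ} (F : L2 t₀ tf → ℝ) (α σ : ℝ) (c w : L2 t₀ tf) : Prop :=
  0 < pred F α c w ∧ (σ : EReal) * pred F α c w ≤ ared F α c w

/-- Trust-region radius in the inner iteration `k` of any outer iteration: reset to `Δ₀`, then
halved after each rejection. -/
def radius (Δ₀ : ℝ) (k : ℕ) : ℝ := Δ₀ / 2 ^ k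

/-- Given iterates `v` and candidates `w n k` (computed in inner iteration `k` of the outer
iteration that starts from `v n`), that outer iteration executes its inner iteration `k`, i.e. all
earlier candidates were rejected. -/
def Reaches {t₀ tf : ℝ} (F : L2 t₀ tf → ℝ) (α σ : ℝ) (v : ℕ → L2 t₀ tf)
    (w : ℕ → ℕ → L2 t₀ tf) (n k : ℕ) : Prop :=
  ∀ j < k, Rejects F α σ (v n) (w n j)

/-- `(v, w, N)` is a full run of the algorithm started at `v₀`. The iterates produced are the `v n`
with `n ≤ N`, where `N = ⊤` if infinitely many are produced; the candidates computed are the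
`w n k` with `n ≤ N` and `Reaches … n k`. Entries of `v` and `w` with other indices are
meaningless and unconstrained. A finite `N` means that in the outer iteration which starts from
`v N` no candidate is ever accepted: either a candidate stops the algorithm, or all candidates are
rejected and the inner loop runs forever. -/
structure IsRun {t₀ tf : ℝ} (F : L2 t₀ tf → ℝ) (V : Finset ℤ) (α σ Δ₀ : ℝ) (v₀ : L2 t₀ tf)
    (v : ℕ → L2 t₀ tf) (w : ℕ → ℕ → L2 t₀ tf) (N : ℕ∞) : Prop where
  /-- The run starts at `v₀`. -/
  init : v 0 = v₀
  /-- Every computed candidate solves the trust-region subproblem at the current iterate. -/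
  candidate : ∀ n k : ℕ, (n : ℕ∞) ≤ N → Reaches F α σ v w n k →
    SolvesTR V α (v n) (gradient F (v n)) (radius Δ₀ k) (w n k)
  /-- Each further iterate is the first candidate that is accepted. -/
  step : ∀ n : ℕ, (n : ℕ∞) < N → ∃ k, Reaches F α σ v w n k ∧
    Accepts F α σ (v n) (w n k) ∧ v (n + 1) = w n k
  /-- From the last iterate no candidate is accepted. -/
  last : ∀ n : ℕ, (n : ℕ∞) = N → ∀ k, Reaches F α σ v w n k → ¬ Accepts F α σ (v n) (w n k)

/-- The algorithm terminates at the iterate `n`. -/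
def TerminatesAt {t₀ tf : ℝ} (F : L2 t₀ tf → ℝ) (α σ : ℝ) (v : ℕ → L2 t₀ tf)
    (w : ℕ → ℕ → L2 t₀ tf) (n : ℕ) : Prop :=
  ∃ k, Reaches F α σ v w n k ∧ Stops F α (v n) (w n k)

/-- The inner loop starting from the iterate `n` does not terminate. -/
def InnerLoopInfinite {t₀ tf : ℝ} (F : L2 t₀ tf → ℝ) (α σ : ℝ) (v : ℕ → L2 t₀ tf)
    (w : ℕ → ℕ → L2 t₀ tf) (n : ℕ) : Prop :=
  ∀ k, Rejects F α σ (v n) (w n k)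

/-- The smallest trust-region radius used in the (terminating) inner loop that starts from the
iterate `n`. -/
def minRadius {t₀ tf : ℝ} (F : L2 t₀ tf → ℝ) (α σ Δ₀ : ℝ) (v : ℕ → L2 t₀ tf)
    (w : ℕ → ℕ → L2 t₀ tf) (n : ℕ) : ℝ :=
  sInf {r | ∃ k, Reaches F α σ v w n k ∧ r = radius Δ₀ k}

/-! ### The three outcomes -/

/-- The sequence of iterates is finite; its final element solves its own trust-region subproblem
for some positive radius and is L-stationary. -/
def OutcomeSolved {t₀ tf : ℝ} (F : L2 t₀ tf → ℝ) (V : Finset ℤ) (α : ℝ) (v : ℕ → L2 t₀ tf)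
    (N : ℕ∞) : Prop :=
  ∃ n : ℕ, N = n ∧ (∃ Δ > 0, SolvesTR V α (v n) (gradient F (v n)) Δ (v n)) ∧
    LStationary F V (v n)

/-- The sequence of iterates is finite; the inner loop does not terminate for its final element,
which is L-stationary. -/
def OutcomeStalled {t₀ tf : ℝ} (F : L2 t₀ tf → ℝ) (V : Finset ℤ) (α σ : ℝ) (v : ℕ → L2 t₀ tf)
    (w : ℕ → ℕ → L2 t₀ tf) (N : ℕ∞) : Prop :=
  ∃ n : ℕ, N = n ∧ InnerLoopInfinite F α σ v w n ∧ LStationary F V (v n)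

/-- The sequence of iterates is infinite and has a weak-* accumulation point in `BV(Ω)`; all of
them are feasible, L-stationary, and strict limits of their approximating subsequences; and if the
trust-region radii along a subsequence are bounded away from zero, then every weak-* accumulation
point of that subsequence solves its own trust-region subproblem for some positive radius. -/
def OutcomeInfinite {t₀ tf : ℝ} (F : L2 t₀ tf → ℝ) (V : Finset ℤ) (α σ Δ₀ : ℝ)
    (v : ℕ → L2 t₀ tf) (w : ℕ → ℕ → L2 t₀ tf) (N : ℕ∞) : Prop :=
  N = ⊤ ∧
  (∃ (u : L2 t₀ tf) (ℓ : ℕ → ℕ), StrictMono ℓ ∧ WeakStarTendsto (v ∘ ℓ) u) ∧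
  (∀ (u : L2 t₀ tf) (ℓ : ℕ → ℕ), StrictMono ℓ → WeakStarTendsto (v ∘ ℓ) u →
    Feasible V u ∧ LStationary F V u ∧ StrictTendsto (v ∘ ℓ) u) ∧
  (∀ ℓ : ℕ → ℕ, StrictMono ℓ →
    0 < liminf (fun i => minRadius F α σ Δ₀ v w (ℓ i)) atTop →
    ∀ (u : L2 t₀ tf) (κ : ℕ → ℕ), StrictMono κ → WeakStarTendsto (v ∘ ℓ ∘ κ) u →
      ∃ Δ > 0, SolvesTR V α u (gradient F u) Δ u)

end

end SLIP

/-! A feasible function of bounded variation is a step function, and since its values are integers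
it has at most `TV` many jumps (`exists_isStepRep`, `IsStepRep.card_le`). Moving one switching
location by a small amount keeps the total variation, costs an `L¹` distance proportional to the
shift, and changes `(∇F(u), ·)` by the jump height times an integral of the gradient next to the
switch. If a Dini sign condition fails, such shifts reduce the linear model at a linear rate in the
distance (`HasLinearDescent`); so a function without linear descent is L-stationary
(`lStationary_of_not_hasLinearDescent`).

The `L¹` Hessian bound makes the error of the linear model quadratic in the `L¹` distance
(`abs_taylor_le`). Hence a rejection at radius `r` forces the best predicted reduction in that trust
region to be `O(r²)` (`ProblemData.linRed_lt_of_rejects`). Rejection at all radii is incompatible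
with linear descent, which settles a stalled inner loop. If the test on `pred` stops the algorithm,
the center itself is optimal in its trust region, which also excludes linear descent.

In an infinite run the objective decreases and is bounded below, so the accepted reductions tend to
zero. For a suitable fixed small radius, either acceptance happened at that radius or a larger one
and the prediction is small because the actual reduction is, or that radius was rejected and the
quadratic bound applies (`IsRun.eventually_linRed_lt`). Taking the accumulation point itself as a
competitor gives an upper bound for the total variations; lower semicontinuity gives the other half,
so convergence is strict (`IsRun.accumulation`). The linear models then converge at every
competitor, and linear descent at the limit would be inherited by late iterates. Existence of
accumulation points comes from pigeonholing the finitely many jump patterns and compactness of the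
switching locations (`exists_weakStarTendsto`). -/

namespace SLIP

variable {t₀ tf : ℝ}

/-! ### The `L¹` and `L²` distances of feasible functions -/

lemma integrable_coe (u : L2 t₀ tf) : Integrable u (volume.restrict (Ioo t₀ tf)) :=
  (Lp.memLp u).integrable one_le_two

lemma l1norm_nonneg (u : L2 t₀ tf) : 0 ≤ l1norm u :=
  integral_nonneg fun _ => abs_nonneg _

lemma l1norm_sub_comm (u w : L2 t₀ tf) : l1norm (u - w) = l1norm (w - u) := by
  refine integral_congr_ae ?_
  filter_upwards [Lp.coeFn_sub u w, Lp.coeFn_sub w u] with x h₁ h₂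
  rw [h₁, h₂, Pi.sub_apply, Pi.sub_apply, abs_sub_comm]

lemma l1norm_sub_le (u w z : L2 t₀ tf) : l1norm (u - z) ≤ l1norm (u - w) + l1norm (w - z) := by
  unfold l1norm
  rw [← integral_add (integrable_coe _).abs (integrable_coe _).abs]
  refine integral_mono_ae (integrable_coe _).abs
    ((integrable_coe _).abs.add (integrable_coe _).abs) ?_
  filter_upwards [Lp.coeFn_sub u w, Lp.coeFn_sub w z, Lp.coeFn_sub u z] with x h₁ h₂ h₃
  simp only [h₁, h₂, h₃, Pi.sub_apply]
  exact abs_sub_le _ _ _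

lemma l1norm_sub_self (u : L2 t₀ tf) : l1norm (u - u) = 0 := by
  unfold l1norm
  rw [sub_self, integral_congr_ae (g := fun _ => (0 : ℝ)), integral_zero]
  filter_upwards [Lp.coeFn_zero ℝ 2 (volume.restrict (Ioo t₀ tf))] with x hx
  rw [hx, Pi.zero_apply, abs_zero]

lemma l1norm_sub_eq (u w : L2 t₀ tf) : l1norm (u - w) = ∫ x in Ioo t₀ tf, |u x - w x| := by
  refine integral_congr_ae ?_
  filter_upwards [Lp.coeFn_sub u w] with x h₁
  rw [h₁, Pi.sub_apply]

lemma inner_eq (u w : L2 t₀ tf) : inner ℝ u w = ∫ x in Ioo t₀ tf, u x * w x := by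
  rw [L2.inner_def]
  refine integral_congr_ae (Eventually.of_forall fun x => ?_)
  simp [mul_comm]

/-- Functions with values in a fixed finite set: the `L²` distance is controlled by the
`L¹` distance. -/
lemma exists_sq_norm_sub_le (t₀ tf : ℝ) (V : Finset ℤ) : ∃ B : ℝ, 0 ≤ B ∧ ∀ u w : L2 t₀ tf,
    Feasible V u → Feasible V w → ‖u - w‖ ^ 2 ≤ B * l1norm (u - w) := by
  refine ⟨2 * ∑ ν ∈ V, |(ν : ℝ)|, by positivity, fun u w hu hw => ?_⟩
  rw [← real_inner_self_eq_norm_sq, inner_eq, l1norm, ← integral_const_mul]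
  have hb : ∀ ν ∈ V, |(ν : ℝ)| ≤ ∑ ν ∈ V, |(ν : ℝ)| := fun ν hν =>
    Finset.single_le_sum (f := fun ν : ℤ => |(ν : ℝ)|) (fun _ _ => abs_nonneg _) hν
  refine integral_mono_ae ?_ ((integrable_coe _).abs.const_mul _) ?_
  · exact L2.integrable_inner (𝕜 := ℝ) (u - w) (u - w)
  filter_upwards [Lp.coeFn_sub u w, hu, hw] with x hx ⟨a, ha, hua⟩ ⟨b, hbV, hwb⟩
  rw [← abs_mul_abs_self]
  refine mul_le_mul_of_nonneg_right ?_ (abs_nonneg _)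
  rw [hx, Pi.sub_apply, hua, hwb]
  have := abs_sub (a : ℝ) b
  linarith [hb a ha, hb b hbV]

lemma tendsto_of_l1norm {ι : Type*} {l : Filter ι} {V : Finset ℤ} {u : ι → L2 t₀ tf}
    {v : L2 t₀ tf} (hu : ∀ i, Feasible V (u i)) (hv : Feasible V v)
    (h : Tendsto (fun i => l1norm (u i - v)) l (𝓝 0)) : Tendsto u l (𝓝 v) := by
  obtain ⟨B, -, hB⟩ := exists_sq_norm_sub_le t₀ tf V
  rw [tendsto_iff_norm_sub_tendsto_zero]
  have h2 : Tendsto (fun i => ‖u i - v‖ ^ 2) l (𝓝 0) :=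
    squeeze_zero (fun _ => sq_nonneg _) (fun i => hB _ _ (hu i) hv) (by simpa using h.const_mul B)
  simpa [Function.comp_def, Real.sqrt_sq (norm_nonneg _)] using
    (Real.continuous_sqrt.tendsto 0).comp h2

/-- The distance of `v x` to the finite, hence closed, set of admissible values is at most `|u i x -
v x|`. Its integral is therefore zero. -/
lemma feasible_of_l1norm {ι : Type*} {l : Filter ι} [l.NeBot] {V : Finset ℤ} {u : ι → L2 t₀ tf}
    {v : L2 t₀ tf} (hu : ∀ i, Feasible V (u i))
    (h : Tendsto (fun i => l1norm (u i - v)) l (𝓝 0)) : Feasible V v := by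
  have hV' : ((fun ν : ℤ => (ν : ℝ)) '' (V : Set ℤ)).Finite := V.finite_toSet.image _
  rcases V.eq_empty_or_nonempty with rfl | hVne
  · obtain ⟨i⟩ := l.nonempty_of_neBot
    filter_upwards [hu i] with x hx
    simp at hx
  set S : Set ℝ := (fun ν : ℤ => (ν : ℝ)) '' (V : Set ℤ)
  have hSne : S.Nonempty := hVne.to_set.image _
  have hcont : Continuous fun y : ℝ => Metric.infDist y S := Metric.continuous_infDist_pt S
  have hle : ∀ i, ∀ᵐ x ∂volume.restrict (Ioo t₀ tf),
      Metric.infDist (v x) S ≤ |(u i - v) x| := fun i => by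
    filter_upwards [hu i, Lp.coeFn_sub (u i) v] with x ⟨ν, hν, hx⟩ h'
    rw [h', Pi.sub_apply, abs_sub_comm, ← Real.dist_eq]
    exact Metric.infDist_le_dist_of_mem (hx ▸ mem_image_of_mem _ hν)
  have hint : Integrable (fun x => Metric.infDist (v x) S) (volume.restrict (Ioo t₀ tf)) := by
    obtain ⟨i⟩ := l.nonempty_of_neBot
    refine (integrable_coe (u i - v)).abs.mono'
      (hcont.comp_aestronglyMeasurable (Lp.aestronglyMeasurable v)) ?_
    filter_upwards [hle i] with x hx
    rwa [Real.norm_of_nonneg Metric.infDist_nonneg]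
  have hzero : ∫ x in Ioo t₀ tf, Metric.infDist (v x) S = 0 := by
    refine le_antisymm ?_ (integral_nonneg fun _ => Metric.infDist_nonneg)
    exact ge_of_tendsto' h fun i => integral_mono_ae hint (integrable_coe _).abs (hle i)
  rw [integral_eq_zero_iff_of_nonneg (fun _ => Metric.infDist_nonneg) hint] at hzero
  filter_upwards [hzero] with x hx
  obtain ⟨ν, hν, h'⟩ := (hV'.isClosed.mem_iff_infDist_zero hSne).2 hx
  exact ⟨ν, hν, h'.symm⟩

/-! ### Test functions and lower semicontinuity of the total variation -/

lemma IsTestFun.exists_bound {φ : ℝ → ℝ} (hφ : IsTestFun t₀ tf φ) :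
    ∃ M : ℝ, 0 ≤ M ∧ ∀ x, |deriv φ x| ≤ M := by
  obtain ⟨M, hM⟩ := (hφ.2.1.deriv).exists_bound_of_continuous
    (hφ.1.continuous_deriv le_rfl)
  exact ⟨M, (norm_nonneg _).trans (hM 0), hM⟩

lemma IsTestFun.integrable_mul {φ : ℝ → ℝ} (hφ : IsTestFun t₀ tf φ) {u : ℝ → ℝ}
    (hu : Integrable u (volume.restrict (Ioo t₀ tf))) :
    Integrable (fun x => u x * deriv φ x) (volume.restrict (Ioo t₀ tf)) := by
  obtain ⟨M, -, hM⟩ := hφ.exists_bound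
  exact hu.mul_bdd (c := M)
    (hφ.1.continuous_deriv le_rfl).aestronglyMeasurable (Eventually.of_forall hM)

lemma le_TV {u : L2 t₀ tf} {φ : ℝ → ℝ} (hφ : IsTestFun t₀ tf φ) (h1 : ∀ x, |φ x| ≤ 1) :
    ENNReal.ofReal (∫ x in Ioo t₀ tf, u x * deriv φ x) ≤ TV u :=
  le_iSup₂_of_le φ ⟨hφ, h1⟩ le_rfl

/-- Derivatives of test functions are bounded, so each integral in the definition of `TV` is
`L¹`-continuous; a supremum of continuous functionals is lower semicontinuous. -/
lemma TV_le_liminf {ι : Type*} {l : Filter ι} {u : ι → L2 t₀ tf} {v : L2 t₀ tf} [l.NeBot]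
    (h : Tendsto (fun i => l1norm (u i - v)) l (𝓝 0)) : TV v ≤ liminf (fun i => TV (u i)) l := by
  refine iSup₂_le fun φ hφ => ?_
  obtain ⟨M, hM0, hM⟩ := hφ.1.exists_bound
  have key : Tendsto (fun i => ∫ x in Ioo t₀ tf, u i x * deriv φ x) l
      (𝓝 (∫ x in Ioo t₀ tf, v x * deriv φ x)) := by
    rw [tendsto_iff_norm_sub_tendsto_zero]
    refine squeeze_zero (fun _ => norm_nonneg _) (fun i => ?_) (by simpa using h.const_mul M)
    rw [← integral_sub (hφ.1.integrable_mul (integrable_coe _))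
      (hφ.1.integrable_mul (integrable_coe _)), l1norm, ← integral_const_mul]
    refine norm_integral_le_of_norm_le ((integrable_coe _).abs.const_mul M) ?_
    filter_upwards [Lp.coeFn_sub (u i) v] with x hx
    rw [hx, Pi.sub_apply, ← sub_mul, norm_mul, mul_comm, Real.norm_eq_abs, Real.norm_eq_abs]
    exact mul_le_mul_of_nonneg_right (hM x) (abs_nonneg _)
  rw [← ((ENNReal.continuous_ofReal.tendsto _).comp key).liminf_eq]
  exact liminf_le_liminf (Eventually.of_forall fun i => le_TV hφ.1 hφ.2)

/-- First-order Taylor estimate with an `L¹` remainder. -/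
lemma abs_taylor_le {F : L2 t₀ tf → ℝ} (hF : ContDiff ℝ 2 F) {C : ℝ}
    (hC : ∀ ξ u w : L2 t₀ tf, |fderiv ℝ (fderiv ℝ F) ξ u w| ≤ C * l1norm u * l1norm w)
    (c w : L2 t₀ tf) :
    |F w - F c - inner ℝ (gradient F c) (w - c)| ≤ C * l1norm (w - c) ^ 2 := by
  set d := w - c
  set l := l1norm d
  have hγ : ∀ t : ℝ, HasDerivAt (fun t : ℝ => c + t • d) d t := fun t => by
    simpa using ((hasDerivAt_id t).smul_const d).const_add c
  have h1 : ∀ t : ℝ, HasDerivAt (fun t : ℝ => F (c + t • d)) (fderiv ℝ F (c + t • d) d) t :=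
    fun t => ((hF.differentiable two_ne_zero).differentiableAt.hasFDerivAt).comp_hasDerivAt t (hγ t)
  have hF' : Differentiable ℝ (fderiv ℝ F) :=
    (hF.fderiv_right (m := 1) (by norm_num)).differentiable one_ne_zero
  have h2 : ∀ t : ℝ, HasDerivAt (fun t : ℝ => fderiv ℝ F (c + t • d) d)
      (fderiv ℝ (fderiv ℝ F) (c + t • d) d d) t := fun t => by
    have := (hF'.differentiableAt.hasFDerivAt (x := c + t • d)).comp_hasDerivAt t (hγ t)
    simpa using this.clm_apply (hasDerivAt_const t d)
  -- The mean value inequality is applied twice along the segment from `c` to `w`: here to the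
  -- directional derivative, below to `F` minus its linear part. This gives the constant `C` in
  -- place of the sharp `C / 2`.
  have hb : ∀ t ∈ Icc (0 : ℝ) 1, ‖fderiv ℝ F (c + t • d) d - fderiv ℝ F c d‖ ≤ C * l ^ 2 := by
    intro t ht
    have h0 : 0 ≤ C * l ^ 2 := by
      have := (abs_nonneg _).trans (hC c d d)
      rw [mul_assoc, ← sq] at this
      exact this
    have := (convex_Icc (0 : ℝ) 1).norm_image_sub_le_of_norm_hasDerivWithin_le (C := C * l ^ 2)
      (fun s _ => (h2 s).hasDerivWithinAt) (fun s _ => by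
        have := hC (c + s • d) d d
        rw [mul_assoc, ← sq] at this
        exact this)
      (left_mem_Icc.2 zero_le_one) ht
    simp only [zero_smul, add_zero, sub_zero] at this
    refine this.trans (mul_le_of_le_one_right h0 ?_)
    rw [Real.norm_of_nonneg ht.1]; exact ht.2
  have h3 : ∀ t : ℝ, HasDerivAt (fun t : ℝ => F (c + t • d) - t * fderiv ℝ F c d)
      (fderiv ℝ F (c + t • d) d - fderiv ℝ F c d) t := fun t => by
    have := (hasDerivAt_id t).mul_const (fderiv ℝ F c d)
    rw [one_mul] at this
    exact (h1 t).sub this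
  have := (convex_Icc (0 : ℝ) 1).norm_image_sub_le_of_norm_hasDerivWithin_le (C := C * l ^ 2)
    (fun s _ => (h3 s).hasDerivWithinAt) hb
    (left_mem_Icc.2 zero_le_one) (right_mem_Icc.2 zero_le_one)
  rw [inner_gradient_left]
  have hcd : c + d = w := by simp [d]
  simp only [zero_smul, one_smul, hcd, add_zero, one_mul, zero_mul, sub_zero, norm_one, mul_one,
    Real.norm_eq_abs] at this
  convert this using 2
  ring

/-! ### Functions with finitely many jumps and their derivatives -/

/-- The right-continuous step function with value `c` at `-∞` and jumps `d i` at `s i`. -/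
noncomputable def jumpFun {ι : Type*} [Fintype ι] (c : ℝ) (d s : ι → ℝ) (x : ℝ) : ℝ :=
  c + ∑ i, (Ici (s i)).indicator (fun _ => d i) x

section

variable {ι : Type*} [Fintype ι]

lemma IsTestFun.eq_zero {φ : ℝ → ℝ} (hφ : IsTestFun t₀ tf φ) {x : ℝ} (hx : x ∉ Ioo t₀ tf) :
    φ x = 0 :=
  image_eq_zero_of_notMem_tsupport fun h => hx (hφ.2.2 h)

/-- The endpoints are allowed for `s` because `φ` vanishes there. Limits of switching locations may
reach the boundary. -/
lemma IsTestFun.integral_indicator_Ici {φ : ℝ → ℝ} (hφ : IsTestFun t₀ tf φ) {s : ℝ}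
    (hs : s ∈ Icc t₀ tf) (d : ℝ) :
    ∫ x in Ioo t₀ tf, (Ici s).indicator (fun _ => d) x * deriv φ x = -(d * φ s) := by
  have h1 : ∀ x, (Ici s).indicator (fun _ => d) x * deriv φ x
      = (Ici s).indicator (fun x => d * deriv φ x) x := fun x => by
    by_cases h : x ∈ Ici s <;> simp [h]
  simp_rw [h1]
  rw [setIntegral_indicator measurableSet_Ici, setIntegral_congr_set
    (t := Ioc s tf), ← intervalIntegral.integral_of_le hs.2, intervalIntegral.integral_const_mul,
    intervalIntegral.integral_deriv_eq_sub' φ rfl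
      (fun x _ => (hφ.1.differentiable one_ne_zero).differentiableAt)
      (hφ.1.continuous_deriv le_rfl).continuousOn, hφ.eq_zero (x := tf) (by simp)]
  · ring
  · have hset : Ioc t₀ tf ∩ Ioi s = Ioc s tf := by
      ext x
      simp only [mem_inter_iff, mem_Ioc, mem_Ioi]
      exact ⟨fun h => ⟨h.2, h.1.2⟩, fun h => ⟨⟨hs.1.trans_lt h.1, h.2⟩, h.1⟩⟩
    rw [← hset]
    exact (Ioo_ae_eq_Ioc (μ := volume)).inter (Ioi_ae_eq_Ici (μ := volume)).symm

lemma integrable_indicator_Ici (s d : ℝ) :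
    Integrable ((Ici s).indicator fun _ => d) (volume.restrict (Ioo t₀ tf)) :=
  (integrable_const d).indicator measurableSet_Ici

lemma integrable_jumpFun (c : ℝ) (d s : ι → ℝ) :
    Integrable (jumpFun c d s) (volume.restrict (Ioo t₀ tf)) :=
  (integrable_const c).add (integrable_finsetSum _ fun _ _ => integrable_indicator_Ici _ _)

lemma IsTestFun.integral_jumpFun {φ : ℝ → ℝ} (hφ : IsTestFun t₀ tf φ) (h : t₀ ≤ tf) (c : ℝ)
    (d s : ι → ℝ) (hs : ∀ i, s i ∈ Icc t₀ tf) :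
    ∫ x in Ioo t₀ tf, jumpFun c d s x * deriv φ x = -∑ i, d i * φ (s i) := by
  have hc : ∫ x in Ioo t₀ tf, c * deriv φ x = 0 := by
    rw [integral_const_mul, ← integral_Ioc_eq_integral_Ioo, ← intervalIntegral.integral_of_le h,
      intervalIntegral.integral_deriv_eq_sub' φ rfl
      (fun x _ => (hφ.1.differentiable one_ne_zero).differentiableAt)
      (hφ.1.continuous_deriv le_rfl).continuousOn, hφ.eq_zero (x := tf) (by simp),
      hφ.eq_zero (x := t₀) (by simp)]
    simp
  simp_rw [jumpFun, add_mul, Finset.sum_mul]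
  rw [integral_add, hc, zero_add, integral_finsetSum]
  · simp_rw [hφ.integral_indicator_Ici (hs _)]
    rw [Finset.sum_neg_distrib]
  · exact fun i _ => hφ.integrable_mul (integrable_indicator_Ici _ _)
  · exact hφ.integrable_mul (integrable_const c)
  · exact integrable_finsetSum _ fun i _ => hφ.integrable_mul (integrable_indicator_Ici _ _)

lemma IsTestFun.integral_of_ae_eq {φ : ℝ → ℝ} (hφ : IsTestFun t₀ tf φ) (h : t₀ ≤ tf) {c : ℝ}
    {d s : ι → ℝ} (hs : ∀ i, s i ∈ Icc t₀ tf) {u : L2 t₀ tf}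
    (hu : u =ᵐ[volume.restrict (Ioo t₀ tf)] jumpFun c d s) :
    ∫ x in Ioo t₀ tf, u x * deriv φ x = -∑ i, d i * φ (s i) := by
  rw [← hφ.integral_jumpFun h c d s hs]
  refine integral_congr_ae ?_
  filter_upwards [hu] with x hx
  rw [hx]

lemma TV_le_of_ae_eq (h : t₀ ≤ tf) {c : ℝ} {d s : ι → ℝ} (hs : ∀ i, s i ∈ Icc t₀ tf)
    {u : L2 t₀ tf} (hu : u =ᵐ[volume.restrict (Ioo t₀ tf)] jumpFun c d s) :
    TV u ≤ ENNReal.ofReal (∑ i, |d i|) := by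
  refine iSup₂_le fun φ hφ => ENNReal.ofReal_le_ofReal ?_
  rw [hφ.1.integral_of_ae_eq h hs hu, ← Finset.sum_neg_distrib]
  refine Finset.sum_le_sum fun i _ => (neg_le_abs _).trans ?_
  rw [abs_mul]
  exact mul_le_of_le_one_right (abs_nonneg _) (hφ.2 _)

/-- Bumps with disjoint supports around the nodes: at each point at most one term of the weighted
sum is nonzero, which gives the bound by one. -/
lemma exists_isTestFun_interpolating {s : ι → ℝ} (hs : ∀ i, s i ∈ Ioo t₀ tf)
    (hinj : Function.Injective s) {ε : ι → ℝ} (hε : ∀ i, |ε i| ≤ 1) :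
    ∃ φ : ℝ → ℝ, IsTestFun t₀ tf φ ∧ (∀ x, |φ x| ≤ 1) ∧ ∀ i, φ (s i) = ε i := by
  obtain ⟨U, hU, hdisj⟩ := (finite_range s).t2_separation
  have hnhds : ∀ i, U (s i) ∩ Ioo t₀ tf ∈ 𝓝 (s i) := fun i =>
    inter_mem ((hU _).2.mem_nhds (hU _).1) (Ioo_mem_nhds (hs i).1 (hs i).2)
  choose f hfs hfc hfd hfr hf1 using fun i => exists_contDiff_tsupport_subset (n := 1) (hnhds i)
  have hzero : ∀ i j x, f i x ≠ 0 → j ≠ i → f j x = 0 := fun i j x hi hji => by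
    by_contra hj
    exact (hdisj (mem_range_self j) (mem_range_self i) (hinj.ne hji)).le_bot
      ⟨(hfs j (subset_tsupport _ hj)).1, (hfs i (subset_tsupport _ hi)).1⟩
  have hsum : ∀ i x, f i x ≠ 0 → ∑ j, ε j * f j x = ε i * f i x := fun i x hi =>
    Finset.sum_eq_single i (fun j _ hj => by rw [hzero i j x hi hj, mul_zero]) (by simp)
  refine ⟨fun x => ∑ i, ε i * f i x, ⟨?_, ?_, ?_⟩, fun x => ?_, fun i => ?_⟩
  · exact ContDiff.sum fun i _ => contDiff_const.mul (hfd i)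
  · refine HasCompactSupport.of_support_subset_isCompact
      (isCompact_iUnion fun i => (hfc i).isCompact) fun x hx => ?_
    obtain ⟨i, -, hi⟩ := Finset.exists_ne_zero_of_sum_ne_zero hx
    exact mem_iUnion.2 ⟨i, subset_tsupport _ (right_ne_zero_of_mul hi)⟩
  · refine (closure_minimal (t := ⋃ i, tsupport (f i)) (fun x hx => ?_)
      (isClosed_iUnion_of_finite fun i => isClosed_tsupport _)).trans
      (iUnion_subset fun i => (hfs i).trans inter_subset_right)
    obtain ⟨i, -, hi⟩ := Finset.exists_ne_zero_of_sum_ne_zero hx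
    exact mem_iUnion.2 ⟨i, subset_tsupport _ (right_ne_zero_of_mul hi)⟩
  · by_cases hx : ∃ i, f i x ≠ 0
    · obtain ⟨i, hi⟩ := hx
      have hr := hfr i (mem_range_self x)
      simp only [hsum i x hi, abs_mul]
      exact mul_le_one₀ (hε i) (abs_nonneg _) (abs_le.2 ⟨by linarith [hr.1], hr.2⟩)
    · push Not at hx
      simp [hx]
  · simp only [hsum i (s i) (by rw [hf1]; exact one_ne_zero), hf1, mul_one]

/-- A test function that takes the value minus the sign of each jump at its location attains the sum
of the jump heights. Distinct locations are essential, since colliding jumps could cancel. -/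
lemma le_TV_of_ae_eq (h : t₀ ≤ tf) {c : ℝ} {d s : ι → ℝ} (hs : ∀ i, s i ∈ Ioo t₀ tf)
    (hinj : Function.Injective s)
    {u : L2 t₀ tf} (hu : u =ᵐ[volume.restrict (Ioo t₀ tf)] jumpFun c d s) :
    ENNReal.ofReal (∑ i, |d i|) ≤ TV u := by
  obtain ⟨φ, hφ, hφ1, hφs⟩ := exists_isTestFun_interpolating hs hinj
    (ε := fun i => -(SignType.sign (d i) : ℝ)) (fun i => by
      rcases lt_trichotomy (d i) 0 with h | h | h <;> simp [h])
  refine le_trans (le_of_eq ?_) (le_TV hφ hφ1)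
  rw [hφ.integral_of_ae_eq h (fun i => Ioo_subset_Icc_self (hs i)) hu, ← Finset.sum_neg_distrib]
  refine congr_arg _ (Finset.sum_congr rfl fun i _ => ?_)
  rw [hφs, mul_neg, neg_neg, self_mul_sign]

lemma integral_sum_dirac (d s : ι → ℝ) {φ : ℝ → ℝ} :
    ∫ᵛ x, φ x ∂•(∑ i, VectorMeasure.dirac (s i) (d i) : SignedMeasure ℝ)
      = ∑ i, d i * φ (s i) := by
  rw [VectorMeasure.integral_finsetSum_vectorMeasure]
  · refine Finset.sum_congr rfl fun i _ => ?_
    rw [VectorMeasure.integral_dirac]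
    simp [mul_comm]
  · intro i _
    rw [VectorMeasure.Integrable, VectorMeasure.variation_dirac]
    exact (integrable_dirac (by simp)).smul_measure (by simp)

lemma hasDerivMeasure_of_ae_eq (h : t₀ ≤ tf) {c : ℝ} {d s : ι → ℝ} (hs : ∀ i, s i ∈ Icc t₀ tf)
    {u : L2 t₀ tf} (hu : u =ᵐ[volume.restrict (Ioo t₀ tf)] jumpFun c d s) :
    HasDerivMeasure u (∑ i, VectorMeasure.dirac (s i) (d i)) := fun φ hφ => by
  rw [hφ.integral_of_ae_eq h hs hu, integral_sum_dirac]

end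

lemma stepFun_eq_jumpFun {m : ℕ} {t : Fin (m + 2) → ℝ} (ht : Monotone t) (a : Fin (m + 1) → ℤ)
    {x : ℝ} (hx : x ∈ Ico (t 0) (t (Fin.last (m + 1)))) :
    stepFun t a x = jumpFun (a 0) (fun i : Fin m => (a i.succ : ℝ) - a i.castSucc)
      (fun i => t i.succ.castSucc) x := by
  classical
  -- Summation by parts: the indicator of a piece is a difference of two Heaviside values, and `H`
  -- equals one at the first node and zero at the last.
  set H : Fin (m + 2) → ℝ := fun i => if t i ≤ x then 1 else 0
  have hind : ∀ i : Fin (m + 1), (Ico (t i.castSucc) (t i.succ)).indicator (fun _ => (a i : ℝ)) x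
      = a i * H i.castSucc - a i * H i.succ := fun i => by
    have hi : t i.castSucc ≤ t i.succ := ht (Fin.castSucc_le_succ i)
    by_cases h1 : t i.castSucc ≤ x
    · by_cases h2 : t i.succ ≤ x
      · simp [H, indicator, h1, h2, not_lt.2 h2]
      · simp [H, indicator, h1, h2, not_le.1 h2]
    · simp [H, indicator, h1, show ¬ t i.succ ≤ x from fun h2 => h1 (hi.trans h2)]
  have hj : ∀ i : Fin m, (Ici (t i.succ.castSucc)).indicator
      (fun _ => (a i.succ : ℝ) - a i.castSucc) x
      = a i.succ * H i.succ.castSucc - a i.castSucc * H i.succ.castSucc := fun i => by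
    by_cases h1 : t i.castSucc.succ ≤ x <;> simp [H, indicator, h1]
  have h0 : H (0 : Fin (m + 1)).castSucc = 1 := by simp [H, hx.1]
  have hl : H (Fin.last m).succ = 0 := by simp [H, hx.2]
  simp only [stepFun, jumpFun, hind, hj, Finset.sum_sub_distrib]
  rw [Fin.sum_univ_succ, Fin.sum_univ_castSucc (fun i => (a i : ℝ) * H i.succ), h0, hl]
  simp only [Fin.succ_castSucc]
  ring

section IsStepRep

variable {V : Finset ℤ} {v : L2 t₀ tf} {m : ℕ} {t : Fin (m + 2) → ℝ} {a : Fin (m + 1) → ℤ}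

lemma IsStepRep.ae_eq_jumpFun (h : IsStepRep V v t a) :
    v =ᵐ[volume.restrict (Ioo t₀ tf)]
      jumpFun (a 0) (fun i : Fin m => (a i.succ : ℝ) - a i.castSucc)
        (fun i => t i.succ.castSucc) := by
  obtain ⟨ht, h0, h1, -, -, hv⟩ := h
  filter_upwards [hv, ae_restrict_mem measurableSet_Ioo] with x hx hxI
  rw [hx, stepFun_eq_jumpFun ht.monotone a]
  rw [h0, h1]
  exact Ioo_subset_Ico_self hxI

lemma IsStepRep.mem_Ioo (h : IsStepRep V v t a) (i : Fin m) : t i.succ.castSucc ∈ Ioo t₀ tf := by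
  obtain ⟨ht, h0, h1, -⟩ := h
  rw [← h0, ← h1]
  exact ⟨ht (by simp [Fin.lt_def]), ht (Fin.castSucc_lt_last _)⟩

lemma IsStepRep.TV_eq (h : IsStepRep V v t a) (hΩ : t₀ ≤ tf) :
    TV v = ENNReal.ofReal (∑ i : Fin m, |(a i.succ : ℝ) - a i.castSucc|) :=
  le_antisymm (TV_le_of_ae_eq hΩ (fun i => Ioo_subset_Icc_self (h.mem_Ioo i)) h.ae_eq_jumpFun)
    (le_TV_of_ae_eq hΩ h.mem_Ioo
      (fun i j hij => by simpa using h.1.injective hij) h.ae_eq_jumpFun)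

lemma IsStepRep.card_le (h : IsStepRep V v t a) (hΩ : t₀ ≤ tf) : (m : ℝ≥0∞) ≤ TV v := by
  rw [h.TV_eq hΩ, ← ENNReal.ofReal_natCast]
  refine ENNReal.ofReal_le_ofReal ?_
  have : ∀ i : Fin m, (1 : ℝ) ≤ |(a i.succ : ℝ) - a i.castSucc| := fun i => by
    exact_mod_cast Int.one_le_abs (sub_ne_zero.2 (h.2.2.2.2.1 i).symm)
  calc (m : ℝ) = ∑ i : Fin m, (1 : ℝ) := by simp
    _ ≤ _ := Finset.sum_le_sum fun i _ => this i

end IsStepRep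

/-! ### Essential variation -/

/-- A smooth approximation of the Heaviside function: the antiderivative of a bump function. -/
lemma exists_smooth_step (φ : ContDiffBump (0 : ℝ)) : ∃ R : ℝ → ℝ,
    (∀ y, HasDerivAt R (φ.normed volume y) y) ∧ Monotone R ∧
    (∀ y, 0 ≤ R y ∧ R y ≤ 1) ∧ (∀ y ≤ -φ.rOut, R y = 0) ∧ (∀ y ≥ φ.rOut, R y = 1) := by
  set ρ := φ.normed volume
  have hρ : Continuous ρ := φ.continuous_normed
  have hsupp : Function.support ρ ⊆ Ioo (-φ.rOut) φ.rOut := by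
    rw [φ.support_normed_eq, Real.ball_eq_Ioo]; simp
  set R : ℝ → ℝ := fun y => ∫ s in (-φ.rOut)..y, ρ s
  have hR : ∀ y, HasDerivAt R (ρ y) y := fun y =>
    (hρ.integral_hasStrictDerivAt (-φ.rOut) y).hasDerivAt
  have hmono : Monotone R := monotone_of_deriv_nonneg (fun y => (hR y).differentiableAt)
    fun y => by rw [(hR y).deriv]; exact φ.nonneg_normed y
  have h0 : ∀ y ≤ -φ.rOut, R y = 0 := fun y hy => by
    refine intervalIntegral.integral_zero_ae (Eventually.of_forall fun x hx => ?_)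
    by_contra h
    rw [uIoc_of_ge hy] at hx
    exact absurd (hsupp h).1 (not_lt.2 hx.2)
  have h1 : ∀ y ≥ φ.rOut, R y = 1 := fun y hy => by
    simp only [R]
    rw [intervalIntegral.integral_eq_integral_of_support_subset, φ.integral_normed]
    exact hsupp.trans fun x hx => ⟨hx.1, hx.2.le.trans hy⟩
  refine ⟨R, hR, hmono, fun y => ⟨?_, ?_⟩, h0, h1⟩
  · rw [← h0 _ (min_le_right y _)]
    exact hmono (min_le_left _ _)
  · rw [← h1 _ (le_max_right y _)]
    exact hmono (le_max_left _ _)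

/-- Summing signed differences of translates of the smooth step produces an admissible test
function. Tested against its derivative, `u` returns the variation of its mollification along `x`.
-/
lemma sum_abs_mollified_le (φ : ContDiffBump (0 : ℝ)) {n : ℕ} {x : ℕ → ℝ} (hx : Monotone x)
    (h0 : t₀ < x 0 - φ.rOut) (hn : x n + φ.rOut < tf) (u : L2 t₀ tf) :
    ENNReal.ofReal (∑ i ∈ Finset.range n, |(∫ y in Ioo t₀ tf, φ.normed volume (x (i + 1) - y) * u y)
      - ∫ y in Ioo t₀ tf, φ.normed volume (x i - y) * u y|) ≤ TV u := by
  obtain ⟨R, hR, hmono, h01, hR0, hR1⟩ := exists_smooth_step φ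
  set ρ := φ.normed volume
  have hρ : Continuous ρ := φ.continuous_normed
  have hneg : ∀ y z, ρ (y - z) = ρ (z - y) := fun y z => by
    rw [← neg_sub]
    exact φ.normed_neg _
  set A : ℕ → ℝ := fun i => ∫ y in Ioo t₀ tf, ρ (x i - y) * u y
  set ε : ℕ → ℝ := fun i => SignType.sign (A i - A (i + 1))
  have hε : ∀ i, |ε i| ≤ 1 := fun i => by
    rcases lt_trichotomy (A i - A (i + 1)) 0 with h | h | h <;> simp [ε, h]
  -- Each difference is a nonnegative smoothed indicator of the piece between consecutive nodes. The
  -- differences telescope, so their sum is at most one, whatever the signs `ε i`.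
  set ψ : ℝ → ℝ := fun y => ∑ i ∈ Finset.range n, ε i * (R (y - x i) - R (y - x (i + 1)))
  have hRder : ∀ y z, HasDerivAt (fun y => R (y - z)) (ρ (y - z)) y := fun y z => by
    simpa using (hR (y - z)).comp_sub_const y z
  have hψd : ∀ y, HasDerivAt ψ
      (∑ i ∈ Finset.range n, ε i * (ρ (y - x i) - ρ (y - x (i + 1)))) y := fun y =>
    HasDerivAt.fun_sum fun i _ => ((hRder y _).sub (hRder y _)).const_mul _
  have hderiv : deriv ψ = fun y => ∑ i ∈ Finset.range n, ε i * (ρ (y - x i) - ρ (y - x (i + 1))) :=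
    funext fun y => (hψd y).deriv
  have hsupp : Function.support ψ ⊆ Icc (x 0 - φ.rOut) (x n + φ.rOut) := by
    intro y hy
    by_contra hI
    refine hy (Finset.sum_eq_zero fun i hi => ?_)
    have hi := Finset.mem_range.1 hi
    have ha := hx (Nat.zero_le i)
    have hb := hx (Nat.zero_le (i + 1))
    have hc := hx hi.le
    have hd := hx (Nat.succ_le_of_lt hi)
    rw [mem_Icc, not_and_or, not_le, not_le] at hI
    rcases hI with h | h
    · rw [hR0 _ (by linarith), hR0 _ (by linarith), sub_self, mul_zero]
    · rw [hR1 _ (by linarith), hR1 _ (by simp only [Nat.succ_eq_add_one] at hd; linarith),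
        sub_self, mul_zero]
  have hts : tsupport ψ ⊆ Icc (x 0 - φ.rOut) (x n + φ.rOut) := closure_minimal hsupp isClosed_Icc
  have hψ : IsTestFun t₀ tf ψ := by
    refine ⟨contDiff_one_iff_deriv.2 ⟨fun y => (hψd y).differentiableAt, ?_⟩,
      HasCompactSupport.of_support_subset_isCompact isCompact_Icc hsupp,
      hts.trans (Icc_subset_Ioo h0 hn)⟩
    rw [hderiv]
    fun_prop
  have hψ1 : ∀ y, |ψ y| ≤ 1 := fun y => by
    refine (Finset.abs_sum_le_sum_abs _ _).trans ?_
    have hle : ∀ i ∈ Finset.range n, |ε i * (R (y - x i) - R (y - x (i + 1)))|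
        ≤ R (y - x i) - R (y - x (i + 1)) := fun i _ => by
      have h : 0 ≤ R (y - x i) - R (y - x (i + 1)) :=
        sub_nonneg.2 (hmono (sub_le_sub_left (hx (Nat.le_succ i)) y))
      rw [abs_mul, abs_of_nonneg h]
      exact mul_le_of_le_one_left h (hε i)
    refine (Finset.sum_le_sum hle).trans ?_
    rw [Finset.sum_range_sub' (fun i => R (y - x i))]
    linarith [(h01 (y - x 0)).2, (h01 (y - x n)).1]
  have hint : ∀ z, Integrable (fun y => ρ (z - y) * u y) (volume.restrict (Ioo t₀ tf)) :=
    fun z => by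
      obtain ⟨M, hM⟩ := φ.hasCompactSupport_normed.exists_bound_of_continuous hρ
      exact (integrable_coe u).bdd_mul (c := M) (by fun_prop) (Eventually.of_forall fun y => hM _)
  refine le_trans (le_of_eq ?_) (le_TV hψ hψ1)
  congr 1
  have hrw : ∀ y, u y * deriv ψ y = ∑ i ∈ Finset.range n,
      (ε i * (ρ (x i - y) * u y) - ε i * (ρ (x (i + 1) - y) * u y)) := fun y => by
    rw [hderiv, Finset.mul_sum]
    refine Finset.sum_congr rfl fun i _ => ?_
    rw [hneg y, hneg y]
    ring
  simp_rw [hrw]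
  have hint' : ∀ i ∈ Finset.range n, Integrable (fun y => ε i * (ρ (x i - y) * u y)
      - ε i * (ρ (x (i + 1) - y) * u y)) (volume.restrict (Ioo t₀ tf)) := fun i _ =>
    ((hint _).const_mul _).sub ((hint _).const_mul _)
  rw [integral_finsetSum _ hint']
  refine Finset.sum_congr rfl fun i _ => ?_
  rw [integral_sub ((hint _).const_mul _) ((hint _).const_mul _), integral_const_mul,
    integral_const_mul, ← mul_sub, abs_sub_comm]
  exact (sign_mul_self (A i - A (i + 1))).symm

/-- The total variation bounds the pointwise variation along a set of full measure. -/
lemma exists_eVariationOn_le (u : L2 t₀ tf) : ∃ S : Set ℝ, S ⊆ Ioo t₀ tf ∧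
    (∀ᵐ x, x ∈ Ioo t₀ tf → x ∈ S) ∧ eVariationOn u S ≤ TV u := by
  set g : ℝ → ℝ := (Ioo t₀ tf).indicator u
  have hg : Integrable g := (integrable_indicator_iff measurableSet_Ioo).2 (integrable_coe u)
  -- The radii tend to zero with fixed ratio two, as needed for a.e. convergence of the
  -- mollifications.
  let φ : ℕ → ContDiffBump (0 : ℝ) := fun k =>
    ⟨1 / (2 * (k + 1)), 1 / (k + 1), by positivity, by
      apply one_div_lt_one_div_of_lt <;> linarith [(Nat.cast_nonneg k : (0 : ℝ) ≤ k)]⟩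
  have hr : Tendsto (fun k => (φ k).rOut) atTop (𝓝 0) := tendsto_one_div_add_atTop_nhds_zero_nat
  have hae := ContDiffBump.ae_convolution_tendsto_right_of_locallyIntegrable (μ := volume)
    (K := 2) hr
    (Eventually.of_forall fun k => le_of_eq (by simp only [φ]; field_simp)) hg.locallyIntegrable
  have hconv : ∀ k x, convolution ((φ k).normed volume) g (ContinuousLinearMap.lsmul ℝ ℝ) volume x
      = ∫ y in Ioo t₀ tf, (φ k).normed volume (x - y) * u y := fun k x => by
    rw [convolution_lsmul_swap, ← integral_indicator measurableSet_Ioo]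
    refine integral_congr_ae (Eventually.of_forall fun y => ?_)
    by_cases hy : y ∈ Ioo t₀ tf <;> simp [g, hy]
  -- `S` consists of the points where the mollifications converge. For a fixed finite partition by
  -- such points the bound passes to the limit, because the bumps eventually fit inside `Ω`.
  refine ⟨Ioo t₀ tf ∩ {x | Tendsto (fun k => convolution ((φ k).normed volume) g
    (ContinuousLinearMap.lsmul ℝ ℝ) volume x) atTop (𝓝 (g x))}, inter_subset_left,
    by filter_upwards [hae] with x hx hxI using ⟨hxI, hx⟩, ?_⟩
  refine iSup_le fun ⟨n, x, hx, hxS⟩ => ?_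
  have hlim : Tendsto (fun k => ENNReal.ofReal (∑ i ∈ Finset.range n,
      |(∫ y in Ioo t₀ tf, (φ k).normed volume (x (i + 1) - y) * u y)
        - ∫ y in Ioo t₀ tf, (φ k).normed volume (x i - y) * u y|)) atTop
      (𝓝 (ENNReal.ofReal (∑ i ∈ Finset.range n, |g (x (i + 1)) - g (x i)|))) := by
    refine ENNReal.tendsto_ofReal (tendsto_finsetSum _ fun i _ => ?_)
    simp_rw [← hconv]
    exact ((hxS (i + 1)).2.sub (hxS i).2).abs
  have hle := le_of_tendsto (b := TV u) hlim (by
    have h1 : ∀ᶠ k in atTop, (φ k).rOut < x 0 - t₀ :=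
      hr.eventually_lt_const (sub_pos.2 (hxS 0).1.1)
    have h2 : ∀ᶠ k in atTop, (φ k).rOut < tf - x n :=
      hr.eventually_lt_const (sub_pos.2 (hxS n).1.2)
    filter_upwards [h1, h2] with k hk1 hk2
    exact sum_abs_mollified_le (φ k) hx (by linarith) (by linarith) u)
  refine le_trans (le_of_eq ?_) hle
  rw [ENNReal.ofReal_sum_of_nonneg fun _ _ => abs_nonneg _]
  refine Finset.sum_congr rfl fun i _ => ?_
  simp only [g, indicator_of_mem (hxS _).1, edist_dist, Real.dist_eq]

/-! ### Step functions on an interval -/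

/-- `f` is a.e. on `(a, b)` a step function with values in `V` and finitely many genuine jumps. -/
def StepOn (V : Finset ℤ) (f : ℝ → ℝ) (a b : ℝ) : Prop :=
  ∃ (m : ℕ) (t : Fin (m + 2) → ℝ) (c : Fin (m + 1) → ℤ), StrictMono t ∧ t 0 = a ∧
    t (Fin.last (m + 1)) = b ∧ (∀ i, c i ∈ V) ∧ (∀ i : Fin m, c i.castSucc ≠ c i.succ) ∧
    ∀ i, ∀ᵐ x, x ∈ Ioo (t i.castSucc) (t i.succ) → f x = c i

lemma StepOn.of_const {V : Finset ℤ} {f : ℝ → ℝ} {a b : ℝ} (hab : a < b) {ν : ℤ} (hν : ν ∈ V)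
    (hf : ∀ᵐ x, x ∈ Ioo a b → f x = ν) : StepOn V f a b := by
  refine ⟨0, ![a, b], ![ν], ?_, rfl, rfl, ?_, fun i => i.elim0, ?_⟩
  · simpa [Fin.strictMono_iff_lt_succ] using hab
  · simpa using hν
  · simpa using hf

lemma StepOn.extend {V : Finset ℤ} {f : ℝ → ℝ} {a b c : ℝ} (h : StepOn V f a b) (hbc : b < c)
    {ν : ℤ} (hν : ν ∈ V) (hf : ∀ᵐ x, x ∈ Ioo b c → f x = ν) : StepOn V f a c := by
  obtain ⟨m, t, e, ht, h0, h1, heV, hne, hfe⟩ := h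
  rw [Fin.strictMono_iff_lt_succ] at ht
  -- If the new value agrees with the last one, the last node is moved from `b` to `c` so that no
  -- spurious jump arises; otherwise a piece is appended.
  by_cases hlast : e (Fin.last m) = ν
  · have htl : t (Fin.last m).castSucc < b := by
      have := ht (Fin.last m)
      rwa [Fin.succ_last, h1] at this
    refine ⟨m, Fin.snoc (α := fun _ => ℝ) (fun i => t i.castSucc) c, e, ?_, ?_, ?_, heV, hne, ?_⟩
    · rw [Fin.strictMono_iff_lt_succ]
      refine Fin.lastCases ?_ fun i => ?_
      · simpa only [Fin.snoc_castSucc, Fin.succ_last, Fin.snoc_last] using htl.trans hbc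
      · simpa only [Fin.snoc_castSucc, Fin.succ_castSucc] using ht i.castSucc
    · rw [← Fin.castSucc_zero, Fin.snoc_castSucc]
      exact h0
    · rw [Fin.snoc_last]
    · refine Fin.lastCases ?_ fun i => ?_
      · have hl := hfe (Fin.last m)
        simp only [Fin.snoc_castSucc, Fin.succ_last, Fin.snoc_last, h1, hlast] at hl ⊢
        filter_upwards [hl, hf, compl_mem_ae_iff.2 (measure_singleton b)] with x h₁ h₂ h₃ hx
        rcases lt_or_gt_of_ne (show x ≠ b from h₃) with h | h
        · exact h₁ ⟨hx.1, h⟩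
        · exact h₂ ⟨h, hx.2⟩
      · have := hfe i.castSucc
        simpa only [Fin.snoc_castSucc, Fin.succ_castSucc] using this
  · refine ⟨m + 1, Fin.snoc (α := fun _ => ℝ) t c, Fin.snoc (α := fun _ => ℤ) e ν,
      ?_, ?_, ?_, ?_, ?_, ?_⟩
    · rw [Fin.strictMono_iff_lt_succ]
      refine Fin.lastCases ?_ fun i => ?_
      · simpa only [Fin.snoc_castSucc, Fin.succ_last, Fin.snoc_last, h1] using hbc
      · simpa only [Fin.snoc_castSucc, Fin.succ_castSucc] using ht i
    · rw [← Fin.castSucc_zero, Fin.snoc_castSucc]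
      exact h0
    · rw [Fin.snoc_last]
    · refine Fin.lastCases ?_ fun i => ?_
      · simpa only [Fin.snoc_last] using hν
      · simpa only [Fin.snoc_castSucc] using heV i
    · refine Fin.lastCases ?_ fun i => ?_
      · simpa only [Fin.snoc_castSucc, Fin.succ_last, Fin.snoc_last] using hlast
      · simpa only [Fin.snoc_castSucc, Fin.succ_castSucc] using hne i
    · refine Fin.lastCases ?_ fun i => ?_
      · simpa only [Fin.snoc_castSucc, Fin.succ_last, Fin.snoc_last, h1] using hf
      · simpa only [Fin.snoc_castSucc, Fin.succ_castSucc] using hfe i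

lemma stepFun_eq_of_mem {m : ℕ} {t : Fin (m + 2) → ℝ} (ht : Monotone t) (a : Fin (m + 1) → ℤ)
    {x : ℝ} {i : Fin (m + 1)} (hx : x ∈ Ico (t i.castSucc) (t i.succ)) : stepFun t a x = a i := by
  rw [stepFun, Finset.sum_eq_single i, indicator_of_mem hx]
  · intro j _ hj
    refine indicator_of_notMem (fun hxj => ?_) _
    rcases lt_or_gt_of_ne hj with h | h
    · exact absurd (hxj.2.trans_le (ht (Fin.succ_le_castSucc_iff.2 h))) (not_lt.2 hx.1)
    · exact absurd (hx.2.trans_le (ht (Fin.succ_le_castSucc_iff.2 h))) (not_lt.2 hxj.1)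
  · simp

lemma exists_mem_Ico {m : ℕ} (t : Fin (m + 1) → ℝ) {x : ℝ} (h0 : t 0 ≤ x)
    (hl : x < t (Fin.last m)) : ∃ i : Fin m, x ∈ Ico (t i.castSucc) (t i.succ) := by
  by_contra! h
  have : ∀ i, t i ≤ x := fun i => by
    induction i using Fin.induction with
    | zero => exact h0
    | succ i ih => exact not_lt.1 fun h' => h i ⟨ih, h'⟩
  exact absurd hl (not_lt.2 (this _))

lemma StepOn.exists_isStepRep {V : Finset ℤ} {v : L2 t₀ tf} (h : StepOn V v t₀ tf) :
    ∃ (m : ℕ) (t : Fin (m + 2) → ℝ) (a : Fin (m + 1) → ℤ), IsStepRep V v t a := by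
  obtain ⟨m, t, a, ht, h0, h1, haV, hne, hv⟩ := h
  refine ⟨m, t, a, ht, h0, h1, haV, hne, ?_⟩
  rw [EventuallyEq, ae_restrict_iff' measurableSet_Ioo]
  have hfin : ∀ᵐ x, ∀ i, x ≠ t i :=
    ae_all_iff.2 fun i => compl_mem_ae_iff.2 (measure_singleton (t i))
  filter_upwards [ae_all_iff.2 hv, hfin] with x hx hxt hxI
  rw [← h0, ← h1] at hxI
  obtain ⟨i, hi⟩ := exists_mem_Ico t hxI.1.le hxI.2
  rw [stepFun_eq_of_mem ht.monotone a hi, hx i ⟨hi.1.lt_of_ne (hxt _).symm, hi.2⟩]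

/-- `p` plays the role of the cumulative variation. Between consecutive integer levels of `p` the
function varies by less than one, and being integer-valued it is constant there. -/
lemma stepOn_of_variation {V : Finset ℤ} {f p : ℝ → ℝ} (hΩ : t₀ < tf) {S : Set ℝ}
    (hSI : S ⊆ Ioo t₀ tf) (hS : ∀ᵐ x, x ∈ Ioo t₀ tf → x ∈ S) (hfV : ∀ x ∈ S, ∃ ν ∈ V, f x = (ν : ℝ))
    {K : ℕ} (hp0 : ∀ x ∈ S, 0 ≤ p x) (hpK : ∀ x ∈ S, p x < K)
    (hpf : ∀ x ∈ S, ∀ y ∈ S, x < y → p x + |f x - f y| ≤ p y) : StepOn V f t₀ tf := by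
  have hdense : ∀ b c, t₀ ≤ b → b < c → c ≤ tf → ∃ x ∈ S, x ∈ Ioo b c := fun b c hb hbc hc => by
    obtain ⟨x, hx, hxI⟩ := (Measure.dense_of_ae hS).exists_mem_open isOpen_Ioo (nonempty_Ioo.2 hbc)
    exact ⟨x, hx ⟨hb.trans_lt hxI.1, hxI.2.trans_le hc⟩, hxI⟩
  -- Inserting `t₀` keeps the set nonempty, so the supremum is `t₀` when no point lies below level
  -- `j`.
  let T : ℕ → Set ℝ := fun j => insert t₀ {x ∈ S | p x < j}
  have hbdd : ∀ j, BddAbove (T j) := fun j => ⟨tf, by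
    rintro x (rfl | hx)
    exacts [hΩ.le, (hSI hx.1).2.le]⟩
  set τ : ℕ → ℝ := fun j => sSup (T j)
  have hτ0 : ∀ j, t₀ ≤ τ j := fun j => le_csSup (hbdd j) (mem_insert _ _)
  have hτf : ∀ j, τ j ≤ tf := fun j => csSup_le ⟨t₀, mem_insert _ _⟩ (by
    rintro x (rfl | hx)
    exacts [hΩ.le, (hSI hx.1).2.le])
  have hmono : ∀ j, τ j ≤ τ (j + 1) := fun j =>
    csSup_le_csSup (hbdd _) ⟨t₀, mem_insert _ _⟩ (insert_subset_insert fun x hx =>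
      ⟨hx.1, hx.2.trans (by push_cast; linarith)⟩)
  have hzero : τ 0 = t₀ := by
    have : T 0 = {t₀} := by
      ext x
      simp only [T, Nat.cast_zero, mem_insert_iff, mem_ofPred_eq, mem_singleton_iff,
        or_iff_left_iff_imp, and_imp]
      exact fun hx hpx => absurd hpx (not_lt.2 (hp0 x hx))
    simp only [τ, this, csSup_singleton]
  have hK : τ K = tf := by
    refine (hτf K).antisymm (le_of_not_gt fun hlt => ?_)
    obtain ⟨x, hxS, hx⟩ := hdense _ _ (hτ0 K) hlt le_rfl
    exact absurd (le_csSup (hbdd K) (mem_insert_of_mem _ ⟨hxS, hpK x hxS⟩)) (not_le.2 hx.1)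
  have hconst : ∀ j, ∀ x ∈ S, ∀ y ∈ S, x ∈ Ioo (τ j) (τ (j + 1)) → y ∈ Ioo (τ j) (τ (j + 1)) →
      x < y → f x = f y := fun j x hx y hy hxI hyI hxy => by
    have h1 : (j : ℝ) ≤ p x := not_lt.1 fun h =>
      absurd (le_csSup (hbdd j) (mem_insert_of_mem _ ⟨hx, h⟩)) (not_le.2 hxI.1)
    obtain ⟨z, hz, hyz⟩ := exists_lt_of_lt_csSup ⟨t₀, mem_insert _ _⟩ hyI.2
    have h2 : p y < j + 1 := by
      rcases hz with rfl | ⟨hzS, hz⟩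
      · exact absurd hyz (not_lt.2 (hSI hy).1.le)
      · push_cast at hz
        linarith [hpf y hy z hzS hyz, abs_nonneg (f y - f z)]
    have h3 := hpf x hx y hy hxy
    obtain ⟨μ, -, hμ⟩ := hfV x hx
    obtain ⟨ν, -, hν⟩ := hfV y hy
    rw [hμ, hν] at h3 ⊢
    have h4 : |((μ - ν : ℤ) : ℝ)| < 1 := by push_cast; linarith
    have h5 : |μ - ν| < 1 := by exact_mod_cast h4
    rw [Int.abs_lt_one_iff, sub_eq_zero] at h5
    rw [h5]
  -- Consecutive thresholds may coincide and the first ones may equal `t₀`, whereas `StepOn` needs a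
  -- nondegenerate interval; hence the disjunction.
  have hind : ∀ j, τ j = t₀ ∨ StepOn V f t₀ (τ j) := fun j => by
    induction j with
    | zero => exact Or.inl hzero
    | succ j ih =>
      rcases (hmono j).eq_or_lt with h | h
      · rwa [← h]
      · obtain ⟨x₀, hx₀S, hx₀⟩ := hdense _ _ (hτ0 j) h (hτf _)
        obtain ⟨ν, hνV, hν⟩ := hfV x₀ hx₀S
        have hae : ∀ᵐ x, x ∈ Ioo (τ j) (τ (j + 1)) → f x = ν := by
          filter_upwards [hS] with x hx hxI
          have hxS := hx ⟨(hτ0 j).trans_lt hxI.1, hxI.2.trans_le (hτf _)⟩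
          rw [← hν]
          rcases lt_trichotomy x x₀ with h' | rfl | h'
          · exact hconst j x hxS x₀ hx₀S hxI hx₀ h'
          · rfl
          · exact (hconst j x₀ hx₀S x hxS hx₀ hxI h').symm
        rcases ih with ih | ih
        · rw [ih] at h hae
          exact Or.inr (StepOn.of_const h hνV hae)
        · exact Or.inr (ih.extend h hνV hae)
  have := hind K
  rw [hK] at this
  exact this.resolve_left hΩ.ne'

/-- Feasible functions of bounded variation are step functions. -/
theorem exists_isStepRep {V : Finset ℤ} {v : L2 t₀ tf} (hΩ : t₀ < tf) (hv : Feasible V v)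
    (hBV : IsBV v) :
    ∃ (m : ℕ) (t : Fin (m + 2) → ℝ) (a : Fin (m + 1) → ℤ), IsStepRep V v t a := by
  obtain ⟨S, hSI, hS, hvar⟩ := exists_eVariationOn_le v
  -- The null set of points with inadmissible values is discarded, so that integrality holds at
  -- every remaining point.
  set S' := S ∩ {x | ∃ ν ∈ V, v x = (ν : ℝ)}
  have hvar' : eVariationOn v S' < ⊤ :=
    (eVariationOn.mono _ inter_subset_left).trans_lt (hvar.trans_lt hBV)
  have hfin : ∀ x, eVariationOn v (S' ∩ Iic x) ≠ ⊤ := fun x =>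
    ((eVariationOn.mono _ inter_subset_left).trans_lt hvar').ne
  obtain ⟨K, hK⟩ := exists_nat_gt (eVariationOn v S').toReal
  refine StepOn.exists_isStepRep (stepOn_of_variation (S := S') (K := K)
    (p := fun x => (eVariationOn v (S' ∩ Iic x)).toReal) hΩ (inter_subset_left.trans hSI) ?_
    (fun x hx => hx.2) (fun _ _ => ENNReal.toReal_nonneg) (fun x _ => ?_) fun x hx y hy hxy => ?_)
  · filter_upwards [hS, (ae_restrict_iff' measurableSet_Ioo).1 hv] with x h₁ h₂ h₃
    exact ⟨h₁ h₃, h₂ h₃⟩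
  · exact (ENNReal.toReal_mono hvar'.ne (eVariationOn.mono _ inter_subset_left)).trans_lt hK
  · have h1 : eVariationOn v (S' ∩ Iic x) + edist (v x) (v y) ≤ eVariationOn v (S' ∩ Iic y) := by
      refine (add_le_add_right (eVariationOn.edist_le v (s := S' ∩ Icc x y)
        ⟨hx, le_rfl, hxy.le⟩ ⟨hy, hxy.le, le_rfl⟩) _).trans
        ((eVariationOn.add_le_union v fun a ha b hb => ha.2.trans hb.2.1).trans
        (eVariationOn.mono _ ?_))
      rintro z (hz | hz)
      exacts [⟨hz.1, hz.2.trans hxy.le⟩, ⟨hz.1, hz.2.2⟩]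
    have h2 := ENNReal.toReal_mono (hfin y) h1
    rwa [ENNReal.toReal_add (hfin x) (edist_ne_top _ _), edist_dist,
      ENNReal.toReal_ofReal dist_nonneg, Real.dist_eq] at h2

/-! ### Shifting a single switching location -/

lemma memLp_jumpFun {ι : Type*} [Fintype ι] (c : ℝ) (d s : ι → ℝ) :
    MemLp (jumpFun c d s) 2 (volume.restrict (Ioo t₀ tf)) :=
  (memLp_const c).add (memLp_finsetSum _ fun _ _ => (memLp_const _).indicator measurableSet_Ici)

lemma exists_isStepRep_of_strictMono {V : Finset ℤ} {m : ℕ} {t : Fin (m + 2) → ℝ}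
    {a : Fin (m + 1) → ℤ} (ht : StrictMono t) (h0 : t 0 = t₀) (h1 : t (Fin.last (m + 1)) = tf)
    (ha : ∀ i, a i ∈ V) (hne : ∀ i : Fin m, a i.castSucc ≠ a i.succ) :
    ∃ w : L2 t₀ tf, IsStepRep V w t a := by
  refine ⟨(memLp_jumpFun (a 0) (fun i : Fin m => (a i.succ : ℝ) - a i.castSucc)
      (fun i => t i.succ.castSucc)).toLp _, ht, h0, h1, ha, hne, ?_⟩
  filter_upwards [MemLp.coeFn_toLp (memLp_jumpFun (t₀ := t₀) (tf := tf) (a 0)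
      (fun i : Fin m => (a i.succ : ℝ) - a i.castSucc) (fun i => t i.succ.castSucc)),
    ae_restrict_mem measurableSet_Ioo] with x hx hxI
  rw [hx, stepFun_eq_jumpFun ht.monotone a]
  rw [h0, h1]
  exact Ioo_subset_Ico_self hxI

lemma IsStepRep.feasible {V : Finset ℤ} {v : L2 t₀ tf} {m : ℕ} {t : Fin (m + 2) → ℝ}
    {a : Fin (m + 1) → ℤ} (h : IsStepRep V v t a) : Feasible V v := by
  obtain ⟨ht, h0, h1, haV, -, hv⟩ := h
  filter_upwards [hv, ae_restrict_mem measurableSet_Ioo] with x hx hxI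
  rw [← h0, ← h1] at hxI
  obtain ⟨i, hi⟩ := exists_mem_Ico t hxI.1.le hxI.2
  exact ⟨a i, haV i, by rw [hx, stepFun_eq_of_mem ht.monotone a hi]⟩

lemma indicator_Ici_sub {a b : ℝ} (hab : a ≤ b) (e x : ℝ) :
    (Ici a).indicator (fun _ => e) x - (Ici b).indicator (fun _ => e) x
      = (Ico a b).indicator (fun _ => e) x := by
  by_cases h1 : a ≤ x <;> by_cases h2 : b ≤ x
  · simp [indicator, h1, h2, not_lt.2 h2]
  · simp [indicator, h1, h2, not_le.1 h2]
  · exact absurd (hab.trans h2) h1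
  · simp [indicator, h1, h2]

lemma setIntegral_mul_indicator_Ico {a b e : ℝ} (ha : t₀ < a) (hab : a ≤ b) (hb : b < tf)
    (f : ℝ → ℝ) :
    ∫ x in Ioo t₀ tf, f x * (Ico a b).indicator (fun _ => e) x = e * ∫ x in a..b, f x := by
  have h1 : ∀ x, f x * (Ico a b).indicator (fun _ => e) x
      = (Ico a b).indicator (fun x => e * f x) x := fun x => by
    by_cases h : x ∈ Ico a b <;> simp [h, mul_comm]
  simp_rw [h1]
  rw [setIntegral_indicator measurableSet_Ico, inter_eq_self_of_subset_right
    (show Ico a b ⊆ Ioo t₀ tf from fun x hx => ⟨ha.trans_le hx.1, hx.2.trans hb⟩),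
    integral_Ico_eq_integral_Ioc,
    ← intervalIntegral.integral_of_le hab, intervalIntegral.integral_const_mul]

lemma l1norm_inner_of_ae_eq_indicator {a b e : ℝ} (ha : t₀ < a) (hab : a ≤ b) (hb : b < tf)
    {u w : L2 t₀ tf} (h : ∀ᵐ x ∂volume.restrict (Ioo t₀ tf),
      w x - u x = (Ico a b).indicator (fun _ => e) x) (g : L2 t₀ tf) :
    l1norm (w - u) = |e| * (b - a) ∧ inner ℝ g (w - u) = e * ∫ x in a..b, g x := by
  constructor
  · rw [l1norm_sub_eq]
    have : ∫ x in Ioo t₀ tf, |w x - u x|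
        = ∫ x in Ioo t₀ tf, 1 * (Ico a b).indicator (fun _ => |e|) x := by
      refine integral_congr_ae ?_
      filter_upwards [h] with x hx
      rw [hx]
      by_cases hx' : x ∈ Ico a b <;> simp [hx']
    rw [this, setIntegral_mul_indicator_Ico ha hab hb]
    simp
  · rw [inner_eq, ← setIntegral_mul_indicator_Ico ha hab hb]
    refine integral_congr_ae ?_
    filter_upwards [h, Lp.coeFn_sub w u] with x hx hx'
    rw [hx', Pi.sub_apply, hx]

section Shift

variable {V : Finset ℤ} {u : L2 t₀ tf} {m : ℕ} {t : Fin (m + 2) → ℝ} {a : Fin (m + 1) → ℤ}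

/-- As long as the moved node stays between its neighbours, the order and the values are untouched,
so the result has the same jumps. All other terms of the two jump sums cancel. -/
lemma IsStepRep.exists_shift (h : IsStepRep V u t a) (i : Fin m) {s : ℝ}
    (hs : s ∈ Ioo (t i.castSucc.castSucc) (t i.succ.succ)) :
    ∃ w : L2 t₀ tf, IsStepRep V w (Function.update t i.succ.castSucc s) a ∧
      ∀ᵐ x ∂volume.restrict (Ioo t₀ tf),
        w x - u x = (Ici s).indicator (fun _ => (a i.succ : ℝ) - a i.castSucc) x
          - (Ici (t i.succ.castSucc)).indicator (fun _ => (a i.succ : ℝ) - a i.castSucc) x := by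
  have hu := h.ae_eq_jumpFun
  obtain ⟨ht, h0, h1, haV, hne, -⟩ := h
  obtain ⟨w, hw⟩ : ∃ w : L2 t₀ tf, IsStepRep V w (Function.update t i.succ.castSucc s) a := by
    refine exists_isStepRep_of_strictMono ?_ ?_ ?_ haV hne
    · rw [Fin.strictMono_iff_lt_succ]
      intro j
      rcases eq_or_ne j.castSucc i.succ.castSucc with hj | hj
      · have hj' : j = i.succ := Fin.castSucc_injective _ hj
        subst hj'
        rw [Function.update_self, Function.update_of_ne]
        · exact hs.2
        · exact (Fin.castSucc_lt_succ (i := i.succ)).ne'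
      · rcases eq_or_ne j.succ i.succ.castSucc with hj2 | hj2
        · have hj' : j = i.castSucc := Fin.succ_injective _ (by rw [hj2, Fin.succ_castSucc])
          subst hj'
          rw [Function.update_of_ne hj, hj2, Function.update_self]
          exact hs.1
        · rw [Function.update_of_ne hj, Function.update_of_ne hj2]
          exact ht Fin.castSucc_lt_succ
    · rw [Function.update_of_ne, h0]
      exact (Fin.castSucc_injective _).ne (Fin.succ_ne_zero i).symm
    · rw [Function.update_of_ne, h1]
      exact (Fin.castSucc_lt_last _).ne'
  refine ⟨w, hw, ?_⟩
  filter_upwards [hu, hw.ae_eq_jumpFun] with x hx hx'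
  rw [hx, hx', jumpFun, jumpFun, add_sub_add_left_eq_sub, ← Finset.sum_sub_distrib,
    Finset.sum_eq_single i]
  · rw [Function.update_self]
  · intro j _ hj
    rw [Function.update_of_ne, sub_self]
    simpa using hj
  · simp

lemma IsStepRep.exists_shift_left (h : IsStepRep V u t a) (hΩ : t₀ ≤ tf) (i : Fin m) {δ : ℝ}
    (hδ : 0 < δ) (hδ' : t i.castSucc.castSucc < t i.succ.castSucc - δ) (g : L2 t₀ tf) :
    ∃ w : L2 t₀ tf, Feasible V w ∧ TV w = TV u ∧
      l1norm (w - u) = |(a i.succ : ℝ) - a i.castSucc| * δ ∧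
      inner ℝ g (w - u) = ((a i.succ : ℝ) - a i.castSucc) *
        ∫ x in (t i.succ.castSucc - δ)..(t i.succ.castSucc), g x := by
  have hI := h.mem_Ioo i
  have hlt : t i.succ.castSucc < t i.succ.succ := h.1 Fin.castSucc_lt_succ
  obtain ⟨w, hw, hwu⟩ := h.exists_shift i (s := t i.succ.castSucc - δ) ⟨hδ', by linarith⟩
  refine ⟨w, hw.feasible, by rw [hw.TV_eq hΩ, h.TV_eq hΩ], ?_⟩
  have hlow : t₀ < t i.succ.castSucc - δ := by
    rw [← h.2.1]
    exact (h.1.monotone (Fin.zero_le _)).trans_lt hδ'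
  convert l1norm_inner_of_ae_eq_indicator hlow (by linarith) hI.2 ?_ g using 3
  · ring
  · filter_upwards [hwu] with x hx
    rw [hx]
    exact indicator_Ici_sub (by linarith) _ x

lemma IsStepRep.exists_shift_right (h : IsStepRep V u t a) (hΩ : t₀ ≤ tf) (i : Fin m) {δ : ℝ}
    (hδ : 0 < δ) (hδ' : t i.succ.castSucc + δ < t i.succ.succ) (g : L2 t₀ tf) :
    ∃ w : L2 t₀ tf, Feasible V w ∧ TV w = TV u ∧
      l1norm (w - u) = |(a i.succ : ℝ) - a i.castSucc| * δ ∧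
      inner ℝ g (w - u) = -((a i.succ : ℝ) - a i.castSucc) *
        ∫ x in (t i.succ.castSucc)..(t i.succ.castSucc + δ), g x := by
  have hI := h.mem_Ioo i
  have hlt : t i.castSucc.castSucc < t i.succ.castSucc :=
    h.1 (Fin.castSucc_lt_castSucc_iff.2 Fin.castSucc_lt_succ)
  obtain ⟨w, hw, hwu⟩ := h.exists_shift i (s := t i.succ.castSucc + δ) ⟨by linarith, hδ'⟩
  refine ⟨w, hw.feasible, by rw [hw.TV_eq hΩ, h.TV_eq hΩ], ?_⟩
  have hup : t i.succ.castSucc + δ < tf := by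
    rw [← h.2.2.1]
    exact hδ'.trans_le (h.1.monotone (Fin.le_last _))
  rw [← abs_neg]
  convert l1norm_inner_of_ae_eq_indicator hI.1 (by linarith) hup ?_ g using 3
  · ring
  · filter_upwards [hwu] with x hx
    rw [hx]
    rw [← neg_sub, indicator_Ici_sub (by linarith : t i.succ.castSucc ≤ t i.succ.castSucc + δ)]
    simp only [indicator]
    split_ifs <;> simp

end Shift

/-! ### Linear descent and L-stationarity -/

/-- There are feasible directions of linear descent for the functional `(g, ·)` at `u`, at every
small `L¹` distance and without an increase of the total variation. -/
def HasLinearDescent (V : Finset ℤ) (u g : L2 t₀ tf) : Prop :=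
  ∃ ε > 0, ∃ ρ₀ > 0, ∀ ρ, 0 < ρ → ρ < ρ₀ → ∃ w : L2 t₀ tf, Feasible V w ∧ TV w = TV u ∧
    l1norm (w - u) ≤ ρ ∧ inner ℝ g (w - u) ≤ -ε * ρ

lemma hasLinearDescent_of_eventually {V : Finset ℤ} {u g : L2 t₀ tf} {D ε : ℝ} (hD : 0 < D)
    (hε : 0 < ε) (h : ∀ᶠ δ in 𝓝[>] (0 : ℝ), ∃ w : L2 t₀ tf, Feasible V w ∧ TV w = TV u ∧
      l1norm (w - u) = D * δ ∧ inner ℝ g (w - u) ≤ -ε * δ) : HasLinearDescent V u g := by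
  obtain ⟨δ₀, hδ₀, hδ⟩ := mem_nhdsGT_iff_exists_Ioo_subset.1 h
  refine ⟨ε / D, div_pos hε hD, D * δ₀, mul_pos hD hδ₀, fun ρ hρ hρ' => ?_⟩
  obtain ⟨w, hw, hTV, hl, hi⟩ := hδ (show ρ / D ∈ Ioo 0 δ₀ from
    ⟨div_pos hρ hD, (div_lt_iff₀' hD).2 hρ'⟩)
  refine ⟨w, hw, hTV, ?_, hi.trans (le_of_eq (by ring))⟩
  rw [hl, mul_div_cancel₀ _ hD.ne']

/-- The limit superior may be `-∞`; a real number strictly between it and zero supplies the uniform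
margin. -/
lemma exists_eventually_lt_of_limsup_neg {f : ℝ → ℝ} {l : Filter ℝ}
    (h : limsup (fun x => (f x : EReal)) l < 0) : ∃ ε > 0, ∀ᶠ x in l, f x < -ε := by
  obtain ⟨q, hq, hq0⟩ := EReal.lt_iff_exists_real_btwn.1 h
  refine ⟨-q, by simpa using (EReal.coe_lt_coe_iff.1 hq0), ?_⟩
  filter_upwards [eventually_lt_of_limsup_lt hq] with x hx
  simpa using hx

lemma exists_eventually_lt_of_liminf_pos {f : ℝ → ℝ} {l : Filter ℝ}
    (h : 0 < liminf (fun x => (f x : EReal)) l) : ∃ ε > 0, ∀ᶠ x in l, ε < f x := by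
  obtain ⟨q, hq0, hq⟩ := EReal.lt_iff_exists_real_btwn.1 h
  refine ⟨q, EReal.coe_lt_coe_iff.1 hq0, ?_⟩
  filter_upwards [eventually_lt_of_lt_liminf hq] with x hx
  simpa using hx

section Dini

variable {V : Finset ℤ} {u : L2 t₀ tf} {m : ℕ} {t : Fin (m + 2) → ℝ} {a : Fin (m + 1) → ℤ}

lemma IsStepRep.hasLinearDescent_left (h : IsStepRep V u t a) (hΩ : t₀ ≤ tf) (i : Fin m)
    {g : L2 t₀ tf} {ε : ℝ} (hε : 0 < ε) (hd : ∀ᶠ δ in 𝓝[>] (0 : ℝ),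
      ((a i.succ : ℝ) - a i.castSucc) *
        (δ⁻¹ * ∫ x in (t i.succ.castSucc - δ)..(t i.succ.castSucc), g x) ≤ -ε) :
    HasLinearDescent V u g := by
  have hne : (a i.succ : ℝ) - a i.castSucc ≠ 0 := by
    exact_mod_cast sub_ne_zero.2 (h.2.2.2.2.1 i).symm
  have hlt : t i.castSucc.castSucc < t i.succ.castSucc :=
    h.1 (Fin.castSucc_lt_castSucc_iff.2 Fin.castSucc_lt_succ)
  refine hasLinearDescent_of_eventually (abs_pos.2 hne) hε ?_
  filter_upwards [hd, Ioo_mem_nhdsGT (sub_pos.2 hlt)] with δ h1 h2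
  obtain ⟨w, hw, hTV, hl, hi⟩ := h.exists_shift_left hΩ i h2.1 (by linarith [h2.2]) g
  refine ⟨w, hw, hTV, hl, ?_⟩
  have := mul_le_mul_of_nonneg_right h1 h2.1.le
  rw [hi]
  refine le_trans (le_of_eq ?_) this
  field_simp [h2.1.ne']

lemma IsStepRep.hasLinearDescent_right (h : IsStepRep V u t a) (hΩ : t₀ ≤ tf) (i : Fin m)
    {g : L2 t₀ tf} {ε : ℝ} (hε : 0 < ε) (hd : ∀ᶠ δ in 𝓝[>] (0 : ℝ),
      ε ≤ ((a i.succ : ℝ) - a i.castSucc) *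
        (δ⁻¹ * ∫ x in (t i.succ.castSucc)..(t i.succ.castSucc + δ), g x)) :
    HasLinearDescent V u g := by
  have hne : (a i.succ : ℝ) - a i.castSucc ≠ 0 := by
    exact_mod_cast sub_ne_zero.2 (h.2.2.2.2.1 i).symm
  have hlt : t i.succ.castSucc < t i.succ.succ := h.1 Fin.castSucc_lt_succ
  refine hasLinearDescent_of_eventually (abs_pos.2 hne) hε ?_
  filter_upwards [hd, Ioo_mem_nhdsGT (sub_pos.2 hlt)] with δ h1 h2
  obtain ⟨w, hw, hTV, hl, hi⟩ := h.exists_shift_right hΩ i h2.1 (by linarith [h2.2]) g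
  refine ⟨w, hw, hTV, hl, ?_⟩
  have := neg_le_neg (mul_le_mul_of_nonneg_right h1 h2.1.le)
  rw [hi, neg_mul ε]
  refine le_trans (le_of_eq ?_) this
  have := h2.1.ne'
  field_simp

/-- The negation of each condition is strict, so it holds with a uniform margin for all small
shifts. A violated left condition is exploited by shifting the switch to the left, a violated right
condition by shifting it to the right. -/
lemma IsStepRep.sign_conditions (h : IsStepRep V u t a) (hΩ : t₀ ≤ tf) {g : L2 t₀ tf}
    (hg : ¬ HasLinearDescent V u g) (i : Fin m) :
    (a i.castSucc < a i.succ → 0 ≤ diniUpperLeft g (t i.succ.castSucc) ∧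
      diniLowerRight g (t i.succ.castSucc) ≤ 0) ∧
    (a i.succ < a i.castSucc → diniLowerLeft g (t i.succ.castSucc) ≤ 0 ∧
      0 ≤ diniUpperRight g (t i.succ.castSucc)) := by
  refine ⟨fun hlt => ?_, fun hlt => ?_⟩
  · have hpos : 0 < (a i.succ : ℝ) - a i.castSucc := sub_pos.2 (by exact_mod_cast hlt)
    constructor <;> by_contra! hcon <;> refine hg ?_
    · obtain ⟨ε, hε, hev⟩ := exists_eventually_lt_of_limsup_neg hcon
      refine h.hasLinearDescent_left hΩ i (mul_pos hpos hε) ?_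
      filter_upwards [hev] with δ hδ
      have := mul_le_mul_of_nonneg_left hδ.le hpos.le
      rwa [mul_neg] at this
    · obtain ⟨ε, hε, hev⟩ := exists_eventually_lt_of_liminf_pos hcon
      refine h.hasLinearDescent_right hΩ i (mul_pos hpos hε) ?_
      filter_upwards [hev] with δ hδ using mul_le_mul_of_nonneg_left hδ.le hpos.le
  · have hneg : (a i.succ : ℝ) - a i.castSucc < 0 := sub_neg.2 (by exact_mod_cast hlt)
    constructor <;> by_contra! hcon <;> refine hg ?_
    · obtain ⟨ε, hε, hev⟩ := exists_eventually_lt_of_liminf_pos hcon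
      refine h.hasLinearDescent_left hΩ i (mul_pos (neg_pos.2 hneg) hε) ?_
      filter_upwards [hev] with δ hδ
      have := mul_le_mul_of_nonpos_left hδ.le hneg.le
      linarith
    · obtain ⟨ε, hε, hev⟩ := exists_eventually_lt_of_limsup_neg hcon
      refine h.hasLinearDescent_right hΩ i (mul_pos (neg_pos.2 hneg) hε) ?_
      filter_upwards [hev] with δ hδ
      have := mul_le_mul_of_nonpos_left hδ.le hneg.le
      linarith

end Dini

theorem lStationary_of_not_hasLinearDescent {F : L2 t₀ tf → ℝ} {V : Finset ℤ} {u : L2 t₀ tf}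
    (hΩ : t₀ < tf) (hu : Feasible V u) (hBV : IsBV u)
    (h : ¬ HasLinearDescent V u (gradient F u)) : LStationary F V u := by
  obtain ⟨m, t, a, hrep⟩ := exists_isStepRep hΩ hu hBV
  exact ⟨hu, hBV, m, t, a, hrep, hrep.sign_conditions hΩ.le h⟩

/-! ### Compactness -/

/-- Away from the limiting jump locations every indicator is eventually constant along the filter.
-/
lemma tendsto_jumpFun {ι κ : Type*} [Fintype ι] {l : Filter κ} (c : ℝ) (d : ι → ℝ)
    {s : κ → ι → ℝ} {s' : ι → ℝ} (hs : Tendsto s l (𝓝 s')) {x : ℝ} (hx : ∀ i, x ≠ s' i) :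
    Tendsto (fun k => jumpFun c d (s k) x) l (𝓝 (jumpFun c d s' x)) := by
  refine tendsto_const_nhds.add (tendsto_finsetSum _ fun i _ => tendsto_const_nhds.congr' ?_)
  have hi := tendsto_pi_nhds.1 hs i
  rcases lt_or_gt_of_ne (hx i) with h | h
  · filter_upwards [hi.eventually_const_lt h] with k hk
    rw [indicator_of_notMem (show x ∉ Ici (s' i) from not_le.2 h),
      indicator_of_notMem (show x ∉ Ici (s k i) from not_le.2 hk)]
  · filter_upwards [hi.eventually_lt_const h] with k hk
    rw [indicator_of_mem (mem_Ici.2 h.le), indicator_of_mem (mem_Ici.2 hk.le)]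

lemma abs_jumpFun_le {ι : Type*} [Fintype ι] (c : ℝ) (d s : ι → ℝ) (x : ℝ) :
    |jumpFun c d s x| ≤ |c| + ∑ i, |d i| := by
  refine (abs_add_le _ _).trans (add_le_add_right ((Finset.abs_sum_le_sum_abs _ _).trans
    (Finset.sum_le_sum fun i _ => ?_)) _)
  rw [indicator]
  split_ifs <;> simp

lemma tendsto_l1norm_jumpFun {ι : Type*} [Fintype ι] {c : ℝ} {d : ι → ℝ}
    {s : ℕ → ι → ℝ} {s' : ι → ℝ} (hs : Tendsto s atTop (𝓝 s')) {u : ℕ → L2 t₀ tf} {v : L2 t₀ tf}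
    (hu : ∀ n, u n =ᵐ[volume.restrict (Ioo t₀ tf)] jumpFun c d (s n))
    (hv : v =ᵐ[volume.restrict (Ioo t₀ tf)] jumpFun c d s') :
    Tendsto (fun n => l1norm (u n - v)) atTop (𝓝 0) := by
  have heq : ∀ n, l1norm (u n - v)
      = ∫ x in Ioo t₀ tf, |jumpFun c d (s n) x - jumpFun c d s' x| := fun n => by
    rw [l1norm_sub_eq]
    refine integral_congr_ae ?_
    filter_upwards [hu n, hv] with x h1 h2
    rw [h1, h2]
  simp_rw [heq]
  have hz : (0 : ℝ) = ∫ x in Ioo t₀ tf, (0 : ℝ) := by simp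
  rw [hz]
  refine tendsto_integral_of_dominated_convergence
    (fun _ => (|c| + ∑ i, |d i|) + (|c| + ∑ i, |d i|))
    (fun n => ((integrable_jumpFun _ _ _).sub (integrable_jumpFun _ _ _)).abs.aestronglyMeasurable)
    (integrable_const _) (fun n => Eventually.of_forall fun x => ?_) ?_
  · rw [Real.norm_eq_abs, abs_abs]
    exact (abs_sub _ _).trans (add_le_add (abs_jumpFun_le _ _ _ _) (abs_jumpFun_le _ _ _ _))
  · have hfin : ∀ᵐ x ∂volume.restrict (Ioo t₀ tf), ∀ i, x ≠ s' i :=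
      ae_restrict_of_ae (ae_all_iff.2 fun i => compl_mem_ae_iff.2 (measure_singleton (s' i)))
    filter_upwards [hfin] with x hx
    simpa using ((tendsto_jumpFun c d hs hx).sub_const (jumpFun c d s' x)).abs

lemma exists_weakStarTendsto_of_isStepRep {V : Finset ℤ} (hΩ : t₀ ≤ tf) {u : ℕ → L2 t₀ tf} {m : ℕ}
    {t : ℕ → Fin (m + 2) → ℝ} {a : Fin (m + 1) → ℤ} (ht : ∀ n, IsStepRep V (u n) (t n) a) :
    ∃ (v : L2 t₀ tf) (κ : ℕ → ℕ), StrictMono κ ∧ WeakStarTendsto (u ∘ κ) v := by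
  obtain ⟨s', hs', κ, hκ, hlim⟩ := (isCompact_univ_pi fun _ : Fin m => isCompact_Icc
    (a := t₀) (b := tf)).tendsto_subseq (x := fun n i => t n i.succ.castSucc)
    (fun n i _ => Ioo_subset_Icc_self ((ht n).mem_Ioo i))
  -- Limit locations may coincide or lie on the boundary, so the limit is given as a `jumpFun`,
  -- which tolerates both.
  obtain ⟨v, hv⟩ : ∃ v : L2 t₀ tf, v =ᵐ[volume.restrict (Ioo t₀ tf)]
      jumpFun (a 0) (fun i : Fin m => (a i.succ : ℝ) - a i.castSucc) s' :=
    ⟨(memLp_jumpFun _ _ _).toLp _, MemLp.coeFn_toLp _⟩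
  refine ⟨v, κ, hκ, tendsto_l1norm_jumpFun hlim (fun n => (ht (κ n)).ae_eq_jumpFun) hv,
    _, _, fun n => hasDerivMeasure_of_ae_eq hΩ
      (fun i => Ioo_subset_Icc_self ((ht (κ n)).mem_Ioo i)) (ht (κ n)).ae_eq_jumpFun,
    hasDerivMeasure_of_ae_eq hΩ (fun i => hs' i (mem_univ i)) hv, fun φ hφ _ => ?_⟩
  simp_rw [integral_sum_dirac]
  exact tendsto_finsetSum _ fun i _ =>
    ((hφ.tendsto _).comp (tendsto_pi_nhds.1 hlim i)).const_mul _

lemma exists_constant_subsequence {Z : Type*} [Finite Z] (z : ℕ → Z) :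
    ∃ (z₀ : Z) (ℓ : ℕ → ℕ), StrictMono ℓ ∧ ∀ n, z (ℓ n) = z₀ := by
  obtain ⟨z₀, hz₀⟩ := Finite.exists_infinite_fiber z
  obtain ⟨ℓ, hℓ, hℓz⟩ := extraction_of_frequently_atTop (P := fun n => z n = z₀)
    (Nat.frequently_atTop_iff_infinite.2 (Set.infinite_coe_iff.1 hz₀))
  exact ⟨z₀, ℓ, hℓ, hℓz⟩

/-- Feasible functions with bounded total variation are weakly-* sequentially precompact. -/
theorem exists_weakStarTendsto {V : Finset ℤ} (hΩ : t₀ < tf) {u : ℕ → L2 t₀ tf}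
    (hu : ∀ n, Feasible V (u n)) {K : ℝ≥0∞} (hK : K < ⊤) (hTV : ∀ n, TV (u n) ≤ K) :
    ∃ (v : L2 t₀ tf) (ℓ : ℕ → ℕ), StrictMono ℓ ∧ WeakStarTendsto (u ∘ ℓ) v := by
  obtain ⟨k, hk⟩ := ENNReal.exists_nat_gt hK.ne
  -- The number of jumps is below `k` and the values lie in `V`, so only finitely many patterns `z`
  -- occur and one of them recurs infinitely often.
  have hP : ∀ n, ∃ z : (Σ m : Fin k, (Fin (m + 1) → V)),
      ∃ t, IsStepRep V (u n) t (fun i => (z.2 i : ℤ)) := fun n => by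
    obtain ⟨m, t, a, h⟩ := exists_isStepRep hΩ (hu n) ((hTV n).trans_lt hK)
    have hmk : m < k := by
      exact_mod_cast (h.card_le hΩ.le).trans_lt ((hTV n).trans_lt hk)
    exact ⟨⟨⟨m, hmk⟩, fun i => ⟨a i, h.2.2.2.1 i⟩⟩, t, h⟩
  choose z hz using hP
  obtain ⟨z₀, ℓ, hℓ, hℓz⟩ := exists_constant_subsequence z
  have hz' : ∀ n, ∃ t, IsStepRep V (u (ℓ n)) t (fun i => (z₀.2 i : ℤ)) := fun n => by
    rw [← hℓz n]
    exact hz _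
  choose t ht using hz'
  obtain ⟨v, κ, hκ, hv⟩ := exists_weakStarTendsto_of_isStepRep hΩ.le ht
  exact ⟨v, ℓ ∘ κ, hℓ.comp hκ, hv⟩

/-! ### Real-valued versions of the algorithmic quantities -/

/-- The total variation as a real number. -/
noncomputable def tvReal (u : L2 t₀ tf) : ℝ := (TV u).toReal

/-- The negative of the trust-region objective as a real number. -/
noncomputable def linRed (α : ℝ) (c g w : L2 t₀ tf) : ℝ :=
  inner ℝ g (c - w) + α * tvReal c - α * tvReal w

/-- The objective as a real number. -/
noncomputable def objReal (F : L2 t₀ tf → ℝ) (α : ℝ) (v : L2 t₀ tf) : ℝ := F v + α * tvReal v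

lemma tvReal_nonneg (u : L2 t₀ tf) : 0 ≤ tvReal u := ENNReal.toReal_nonneg

lemma coe_TV {u : L2 t₀ tf} (hu : IsBV u) : (TV u : EReal) = (tvReal u : EReal) :=
  (EReal.coe_ennreal_toReal hu.ne).symm

lemma ofReal_tvReal {u : L2 t₀ tf} (hu : IsBV u) : ENNReal.ofReal (tvReal u) = TV u :=
  ENNReal.ofReal_toReal hu.ne

lemma J_eq {F : L2 t₀ tf → ℝ} {α : ℝ} {v : L2 t₀ tf} (hv : IsBV v) :
    J F α v = (objReal F α v : EReal) := by
  rw [J, coe_TV hv, objReal]; norm_cast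

lemma trObjective_eq {α : ℝ} {c g w : L2 t₀ tf} (hc : IsBV c) (hw : IsBV w) :
    trObjective α c g w = ((-linRed α c g w : ℝ) : EReal) := by
  rw [trObjective, coe_TV hc, coe_TV hw]
  norm_cast
  rw [linRed, ← neg_sub c w, inner_neg_right]
  ring

lemma trObjective_of_not_isBV {α : ℝ} (hα : 0 < α) {c g w : L2 t₀ tf} (hc : IsBV c)
    (hw : ¬ IsBV w) : trObjective α c g w = ⊤ := by
  have hw' : TV w = ⊤ := not_lt_top_iff.1 hw
  rw [trObjective, coe_TV hc, hw', EReal.coe_ennreal_top, EReal.coe_mul_top_of_pos hα,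
    EReal.coe_add_top, ← EReal.coe_mul, EReal.top_sub_coe]

lemma pred_eq {F : L2 t₀ tf → ℝ} {α : ℝ} {c w : L2 t₀ tf} (hc : IsBV c) (hw : IsBV w) :
    pred F α c w = (linRed α c (gradient F c) w : EReal) := by
  rw [pred, coe_TV hc, coe_TV hw, linRed]; norm_cast

lemma ared_eq {F : L2 t₀ tf → ℝ} {α : ℝ} {c w : L2 t₀ tf} (hc : IsBV c) (hw : IsBV w) :
    ared F α c w = ((objReal F α c - objReal F α w : ℝ) : EReal) := by
  rw [ared, J_eq hc, J_eq hw]; norm_cast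

lemma stops_iff {F : L2 t₀ tf → ℝ} {α : ℝ} {c w : L2 t₀ tf} (hc : IsBV c) (hw : IsBV w) :
    Stops F α c w ↔ linRed α c (gradient F c) w ≤ 0 := by
  rw [Stops, pred_eq hc hw]; norm_cast

lemma rejects_iff {F : L2 t₀ tf → ℝ} {α σ : ℝ} {c w : L2 t₀ tf} (hc : IsBV c) (hw : IsBV w) :
    Rejects F α σ c w ↔ 0 < linRed α c (gradient F c) w ∧
      objReal F α c - objReal F α w < σ * linRed α c (gradient F c) w := by
  rw [Rejects, pred_eq hc hw, ared_eq hc hw]; norm_cast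

lemma accepts_iff {F : L2 t₀ tf → ℝ} {α σ : ℝ} {c w : L2 t₀ tf} (hc : IsBV c) (hw : IsBV w) :
    Accepts F α σ c w ↔ 0 < linRed α c (gradient F c) w ∧
      σ * linRed α c (gradient F c) w ≤ objReal F α c - objReal F α w := by
  rw [Accepts, pred_eq hc hw, ared_eq hc hw]; norm_cast

@[simp] lemma linRed_self (α : ℝ) (c g : L2 t₀ tf) : linRed α c g c = 0 := by
  simp [linRed]

/-! ### Minimizers of the trust-region subproblem -/

section TrustRegion

variable {V : Finset ℤ} {α Δ : ℝ} {c g w : L2 t₀ tf}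

/-- The center is a competitor with finite objective, while infinite variation would give the value
`⊤`. -/
lemma SolvesTR.isBV (h : SolvesTR V α c g Δ w) (hα : 0 < α) (hc : Feasible V c) (hcBV : IsBV c)
    (hΔ : 0 ≤ Δ) : IsBV w := by
  by_contra hw
  have := h.2 c ⟨hc, (l1norm_sub_self c).trans_le hΔ⟩
  rw [trObjective_of_not_isBV hα hcBV hw, trObjective_eq hcBV hcBV, top_le_iff] at this
  exact EReal.coe_ne_top _ this

lemma SolvesTR.linRed_le (h : SolvesTR V α c g Δ w) (hcBV : IsBV c) (hwBV : IsBV w)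
    {z : L2 t₀ tf} (hz : Feasible V z) (hzBV : IsBV z) (hzΔ : l1norm (z - c) ≤ Δ) :
    linRed α c g z ≤ linRed α c g w := by
  have := h.2 z ⟨hz, hzΔ⟩
  rw [trObjective_eq hcBV hwBV, trObjective_eq hcBV hzBV] at this
  exact neg_le_neg_iff.1 (EReal.coe_le_coe_iff.1 this)

lemma solvesTR_self (hα : 0 < α) (hc : Feasible V c) (hcBV : IsBV c) (hΔ : 0 ≤ Δ)
    (h : ∀ z, Feasible V z → IsBV z → l1norm (z - c) ≤ Δ → linRed α c g z ≤ 0) :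
    SolvesTR V α c g Δ c := by
  refine ⟨⟨hc, (l1norm_sub_self c).trans_le hΔ⟩, fun z hz => ?_⟩
  by_cases hzBV : IsBV z
  · rw [trObjective_eq hcBV hcBV, trObjective_eq hcBV hzBV, EReal.coe_le_coe_iff, linRed_self]
    linarith [h z hz.1 hzBV hz.2]
  · rw [trObjective_of_not_isBV hα hcBV hzBV]
    exact le_top

lemma HasLinearDescent.exists_linRed_ge (h : HasLinearDescent V c g) (hcBV : IsBV c) (α : ℝ) :
    ∃ ε > 0, ∃ ρ₀ > 0, ∀ ρ, 0 < ρ → ρ < ρ₀ → ∃ z : L2 t₀ tf, Feasible V z ∧ IsBV z ∧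
      l1norm (z - c) ≤ ρ ∧ ε * ρ ≤ linRed α c g z := by
  obtain ⟨ε, hε, ρ₀, hρ₀, h⟩ := h
  refine ⟨ε, hε, ρ₀, hρ₀, fun ρ hρ hρ' => ?_⟩
  obtain ⟨z, hz, hTV, hl, hi⟩ := h ρ hρ hρ'
  refine ⟨z, hz, by rwa [IsBV, hTV], hl, ?_⟩
  rw [linRed, tvReal, tvReal, hTV, ← neg_sub z c, inner_neg_right]
  linarith

lemma SolvesTR.not_hasLinearDescent (h : SolvesTR V α c g Δ c) (hΔ : 0 < Δ) (hcBV : IsBV c) :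
    ¬ HasLinearDescent V c g := fun hd => by
  obtain ⟨ε, hε, ρ₀, hρ₀, hd⟩ := hd.exists_linRed_ge hcBV α
  have hρ : 0 < min Δ (ρ₀ / 2) := lt_min hΔ (half_pos hρ₀)
  obtain ⟨z, hz, hzBV, hl, hi⟩ := hd _ hρ ((min_le_right _ _).trans_lt (half_lt_self hρ₀))
  have := h.linRed_le hcBV hcBV hz hzBV (hl.trans (min_le_left _ _))
  rw [linRed_self] at this
  linarith [mul_pos hε hρ]

end TrustRegion

lemma radius_pos {Δ₀ : ℝ} (hΔ₀ : 0 < Δ₀) (k : ℕ) : 0 < radius Δ₀ k := by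
  unfold radius; positivity

lemma radius_antitone {Δ₀ : ℝ} (hΔ₀ : 0 < Δ₀) : Antitone (radius Δ₀) := fun k l h =>
  div_le_div_of_nonneg_left hΔ₀.le (by positivity) (pow_le_pow_right₀ one_le_two h)

lemma exists_radius_lt (Δ₀ : ℝ) {ρ : ℝ} (hρ : 0 < ρ) : ∃ k, radius Δ₀ k < ρ := by
  have : Tendsto (radius Δ₀) atTop (𝓝 0) := by
    have := (tendsto_pow_atTop_nhds_zero_of_lt_one (r := (1 / 2 : ℝ)) (by norm_num)
      (by norm_num)).const_mul Δ₀
    rw [mul_zero] at this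
    refine this.congr fun k => ?_
    rw [radius, one_div, inv_pow, div_eq_mul_inv]
  exact (this.eventually_lt_const hρ).exists

/-- The data of the optimization problem. -/
structure ProblemData (F : L2 t₀ tf → ℝ) (α C σ Δ₀ : ℝ) : Prop where
  alpha_pos : 0 < α
  contDiff : ContDiff ℝ 2 F
  hess_le : ∀ ξ u w : L2 t₀ tf,
    |fderiv ℝ (fderiv ℝ F) ξ u w| ≤ C * l1norm u * l1norm w
  const_pos : 0 < C
  sigma_pos : 0 < σ
  sigma_lt : σ < 1
  delta_pos : 0 < Δ₀

/-! ### Consequences of a rejected step -/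

section Step

variable {F : L2 t₀ tf → ℝ} {α C σ Δ₀ : ℝ} {V : Finset ℤ} {r : ℝ} {c w : L2 t₀ tf}

/-- If the trust-region step with radius `r` is rejected, then the linear model predicts a reduction
of order at most `r ^ 2` in the whole trust region. -/
lemma ProblemData.linRed_lt_of_rejects (hP : ProblemData F α C σ Δ₀) (hc : Feasible V c)
    (hcBV : IsBV c) (hr : 0 ≤ r) (hw : SolvesTR V α c (gradient F c) r w)
    (hrej : Rejects F α σ c w) {z : L2 t₀ tf} (hz : Feasible V z) (hzBV : IsBV z)
    (hzr : l1norm (z - c) ≤ r) : (1 - σ) * linRed α c (gradient F c) z < C * r ^ 2 := by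
  have hwBV := hw.isBV hP.alpha_pos hc hcBV hr
  -- The actual reduction differs from the prediction by the Taylor remainder. Falling short of `σ`
  -- times the prediction thus forces `1 - σ` times the prediction below that remainder.
  obtain ⟨-, hrej⟩ := (rejects_iff hcBV hwBV).1 hrej
  have h1 := (abs_le.1 (abs_taylor_le hP.contDiff hP.hess_le c w)).2
  have h2 : C * l1norm (w - c) ^ 2 ≤ C * r ^ 2 :=
    mul_le_mul_of_nonneg_left (pow_le_pow_left₀ (l1norm_nonneg _) hw.1.2 2) hP.const_pos.le
  have h3 := hw.linRed_le hcBV hwBV hz hzBV hzr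
  have h4 : (1 - σ) * linRed α c (gradient F c) z ≤ (1 - σ) * linRed α c (gradient F c) w :=
    mul_le_mul_of_nonneg_left h3 (by linarith [hP.sigma_lt])
  refine h4.trans_lt ?_
  rw [← neg_sub c w, inner_neg_right] at h1
  have h5 : linRed α c (gradient F c) w
      = inner ℝ (gradient F c) (c - w) + α * tvReal c - α * tvReal w := rfl
  simp only [objReal] at hrej
  rw [neg_sub] at h1
  linarith

/-- Linear descent predicts at least `ε * r` at radius `r`, whereas rejection allows less than `C *
r ^ 2 / (1 - σ)`. These conflict once `r` is below `(1 - σ) * ε / C`. -/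
lemma ProblemData.not_hasLinearDescent_of_rejects (hP : ProblemData F α C σ Δ₀)
    (hc : Feasible V c) (hcBV : IsBV c) {w : ℕ → L2 t₀ tf}
    (hw : ∀ k, SolvesTR V α c (gradient F c) (radius Δ₀ k) (w k))
    (hrej : ∀ k, Rejects F α σ c (w k)) : ¬ HasLinearDescent V c (gradient F c) := fun hd => by
  obtain ⟨ε, hε, ρ₀, hρ₀, hd⟩ := hd.exists_linRed_ge hcBV α
  have hσ : 0 < 1 - σ := sub_pos.2 hP.sigma_lt
  obtain ⟨k, hk⟩ := exists_radius_lt Δ₀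
    (lt_min hρ₀ (div_pos (mul_pos hσ hε) hP.const_pos))
  have hr := radius_pos hP.delta_pos k
  obtain ⟨z, hz, hzBV, hl, hi⟩ := hd _ hr (hk.trans_le (min_le_left _ _))
  have h1 := hP.linRed_lt_of_rejects hc hcBV hr.le (hw k) (hrej k) hz hzBV hl
  have h2 := (lt_div_iff₀ hP.const_pos).1 (hk.trans_le (min_le_right _ _))
  have h3 := mul_le_mul_of_nonneg_left hi hσ.le
  have h4 := mul_lt_mul_of_pos_right h2 hr
  nlinarith

end Step

/-! ### Invariants of a run -/

section Run

variable {F : L2 t₀ tf → ℝ} {α C σ Δ₀ : ℝ} {V : Finset ℤ} {v₀ : L2 t₀ tf} {v : ℕ → L2 t₀ tf}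
  {w : ℕ → ℕ → L2 t₀ tf} {N : ℕ∞}

lemma IsRun.feasible_isBV (hrun : IsRun F V α σ Δ₀ v₀ v w N) (hP : ProblemData F α C σ Δ₀)
    (hv₀ : Feasible V v₀) (hv₀BV : IsBV v₀) (n : ℕ) (hn : (n : ℕ∞) ≤ N) :
    Feasible V (v n) ∧ IsBV (v n) := by
  induction n with
  | zero => rw [hrun.init]; exact ⟨hv₀, hv₀BV⟩
  | succ n ih =>
    have hlt : (n : ℕ∞) < N := lt_of_lt_of_le (by exact_mod_cast n.lt_succ_self) hn
    obtain ⟨hf, hBV⟩ := ih hlt.le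
    obtain ⟨k, hk, -, hvk⟩ := hrun.step n hlt
    have hsol := hrun.candidate n k hlt.le hk
    rw [hvk]
    exact ⟨hsol.1.1, hsol.isBV hP.alpha_pos hf hBV (radius_pos hP.delta_pos k).le⟩

lemma IsRun.step_real (hrun : IsRun F V α σ Δ₀ v₀ v w N) (hP : ProblemData F α C σ Δ₀)
    (hv₀ : Feasible V v₀) (hv₀BV : IsBV v₀) (n : ℕ) (hn : (n : ℕ∞) < N) :
    ∃ k, Reaches F α σ v w n k ∧ 0 < linRed α (v n) (gradient F (v n)) (w n k) ∧
      SolvesTR V α (v n) (gradient F (v n)) (radius Δ₀ k) (w n k) ∧ IsBV (w n k) ∧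
      σ * linRed α (v n) (gradient F (v n)) (w n k)
        ≤ objReal F α (v n) - objReal F α (v (n + 1)) := by
  obtain ⟨k, hk, hacc, hvk⟩ := hrun.step n hn
  obtain ⟨hf, hBV⟩ := hrun.feasible_isBV hP hv₀ hv₀BV n hn.le
  have hsol := hrun.candidate n k hn.le hk
  have hwBV := hsol.isBV hP.alpha_pos hf hBV (radius_pos hP.delta_pos k).le
  obtain ⟨h1, h2⟩ := (accepts_iff hBV hwBV).1 hacc
  rw [← hvk] at h2
  exact ⟨k, hk, h1, hsol, hwBV, by rwa [hvk] at h2 ⊢⟩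

lemma IsRun.objReal_lt (hrun : IsRun F V α σ Δ₀ v₀ v w N) (hP : ProblemData F α C σ Δ₀)
    (hv₀ : Feasible V v₀) (hv₀BV : IsBV v₀) (n : ℕ) (hn : (n : ℕ∞) < N) :
    objReal F α (v (n + 1)) < objReal F α (v n) := by
  obtain ⟨k, -, hpos, -, -, h⟩ := hrun.step_real hP hv₀ hv₀BV n hn
  linarith [mul_pos hP.sigma_pos hpos]

/-! ### Finite runs -/

lemma IsRun.lStationary_of_innerLoopInfinite (hrun : IsRun F V α σ Δ₀ v₀ v w N)
    (hP : ProblemData F α C σ Δ₀) (hΩ : t₀ < tf) (hv₀ : Feasible V v₀) (hv₀BV : IsBV v₀) {n : ℕ}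
    (hn : (n : ℕ∞) = N) (hinf : InnerLoopInfinite F α σ v w n) : LStationary F V (v n) := by
  obtain ⟨hf, hBV⟩ := hrun.feasible_isBV hP hv₀ hv₀BV n hn.le
  exact lStationary_of_not_hasLinearDescent hΩ hf hBV (hP.not_hasLinearDescent_of_rejects hf hBV
    (fun k => hrun.candidate n k hn.le fun j _ => hinf j) hinf)

lemma IsRun.solves_of_terminatesAt (hrun : IsRun F V α σ Δ₀ v₀ v w N)
    (hP : ProblemData F α C σ Δ₀) (hΩ : t₀ < tf) (hv₀ : Feasible V v₀) (hv₀BV : IsBV v₀) {n : ℕ}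
    (hn : (n : ℕ∞) = N) (hterm : TerminatesAt F α σ v w n) : OutcomeSolved F V α v N := by
  obtain ⟨hf, hBV⟩ := hrun.feasible_isBV hP hv₀ hv₀BV n hn.le
  obtain ⟨k, hk, hpred⟩ := hterm
  have hr := radius_pos hP.delta_pos k
  have hsol := hrun.candidate n k hn.le hk
  have hwBV := hsol.isBV hP.alpha_pos hf hBV hr.le
  rw [stops_iff hBV hwBV] at hpred
  have hself : SolvesTR V α (v n) (gradient F (v n)) (radius Δ₀ k) (v n) :=
    solvesTR_self hP.alpha_pos hf hBV hr.le fun z hz hzBV hl =>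
      (hsol.linRed_le hBV hwBV hz hzBV hl).trans hpred
  exact ⟨n, hn.symm, ⟨_, hr, hself⟩,
    lStationary_of_not_hasLinearDescent hΩ hf hBV (hself.not_hasLinearDescent hr hBV)⟩

/-- At the final iterate a computed candidate is never accepted. If none stops the algorithm, each
is rejected, and so the next one is computed. -/
lemma IsRun.terminatesAt_or_innerLoopInfinite (hrun : IsRun F V α σ Δ₀ v₀ v w N) {n : ℕ}
    (hn : (n : ℕ∞) = N) : TerminatesAt F α σ v w n ∨ InnerLoopInfinite F α σ v w n := by
  by_contra! hcon
  obtain ⟨hterm, hinf⟩ := hcon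
  refine hinf fun k => ?_
  induction k using Nat.strong_induction_on with
  | _ k ih =>
    have hk : Reaches F α σ v w n k := ih
    have hpos : 0 < pred F α (v n) (w n k) := not_le.1 fun h => hterm ⟨k, hk, h⟩
    exact ⟨hpos, not_le.1 fun h => hrun.last n hn k hk ⟨hpos, h⟩⟩

/-- Halving eventually brings the radius below `Δ`. The candidate then competes in the problem
solved by the center, so its predicted reduction is not positive and it cannot be rejected. This
separates the two finite outcomes. -/
lemma IsRun.not_innerLoopInfinite_of_solvesTR (hrun : IsRun F V α σ Δ₀ v₀ v w N)
    (hP : ProblemData F α C σ Δ₀) (hv₀ : Feasible V v₀) (hv₀BV : IsBV v₀) {n : ℕ}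
    (hn : (n : ℕ∞) = N) {Δ : ℝ} (hΔ : 0 < Δ)
    (hsol : SolvesTR V α (v n) (gradient F (v n)) Δ (v n)) :
    ¬ InnerLoopInfinite F α σ v w n := fun hinf => by
  obtain ⟨hf, hBV⟩ := hrun.feasible_isBV hP hv₀ hv₀BV n hn.le
  obtain ⟨k, hk⟩ := exists_radius_lt Δ₀ hΔ
  have hcand := hrun.candidate n k hn.le fun j _ => hinf j
  have hwBV := hcand.isBV hP.alpha_pos hf hBV (radius_pos hP.delta_pos k).le
  have h1 := hsol.linRed_le hBV hBV hcand.1.1 hwBV (hcand.1.2.trans hk.le)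
  have h2 := ((rejects_iff hBV hwBV).1 (hinf k)).1
  rw [linRed_self] at h1
  exact absurd h2 (not_lt.2 h1)

/-! ### Infinite runs -/

lemma IsRun.tendsto_objReal_sub (hrun : IsRun F V α σ Δ₀ v₀ v w ⊤) (hP : ProblemData F α C σ Δ₀)
    (hFbdd : BddBelow (range F)) (hv₀ : Feasible V v₀) (hv₀BV : IsBV v₀) :
    Tendsto (fun n => objReal F α (v n) - objReal F α (v (n + 1))) atTop (𝓝 0) := by
  obtain ⟨b, hb⟩ := hFbdd
  have hanti : Antitone fun n => objReal F α (v n) := antitone_nat_of_succ_le fun n =>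
    (hrun.objReal_lt hP hv₀ hv₀BV n (ENat.natCast_lt_top n)).le
  have hbdd : BddBelow (range fun n => objReal F α (v n)) := ⟨b, by
    rintro _ ⟨n, rfl⟩
    have := mul_nonneg hP.alpha_pos.le (tvReal_nonneg (v n))
    linarith [hb (mem_range_self (v n)), show objReal F α (v n) = F (v n) + α * tvReal (v n)
      from rfl]⟩
  have hlim := tendsto_atTop_ciInf hanti hbdd
  simpa using hlim.sub (hlim.comp (tendsto_add_atTop_nat 1))

lemma IsRun.exists_TV_le (hrun : IsRun F V α σ Δ₀ v₀ v w ⊤) (hP : ProblemData F α C σ Δ₀)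
    (hFbdd : BddBelow (range F)) (hv₀ : Feasible V v₀) (hv₀BV : IsBV v₀) :
    ∃ K : ℝ≥0∞, K < ⊤ ∧ ∀ n, TV (v n) ≤ K := by
  obtain ⟨b, hb⟩ := hFbdd
  have hanti : Antitone fun n => objReal F α (v n) := antitone_nat_of_succ_le fun n =>
    (hrun.objReal_lt hP hv₀ hv₀BV n (ENat.natCast_lt_top n)).le
  refine ⟨ENNReal.ofReal ((objReal F α (v 0) - b) / α), ENNReal.ofReal_lt_top, fun n => ?_⟩
  rw [← ofReal_tvReal (hrun.feasible_isBV hP hv₀ hv₀BV n le_top).2]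
  refine ENNReal.ofReal_le_ofReal ((le_div_iff₀ hP.alpha_pos).2 ?_)
  have h1 : F (v n) + α * tvReal (v n) ≤ objReal F α (v 0) := hanti (Nat.zero_le n)
  linarith [hb (mem_range_self (v n))]

/-- In an infinite run the linear models eventually predict no more than an arbitrarily small
reduction in a trust region of suitable fixed radius. -/
lemma IsRun.eventually_linRed_lt (hrun : IsRun F V α σ Δ₀ v₀ v w ⊤)
    (hP : ProblemData F α C σ Δ₀) (hFbdd : BddBelow (range F)) (hv₀ : Feasible V v₀)
    (hv₀BV : IsBV v₀) {δ : ℝ} (hδ : 0 < δ) {k₀ : ℕ}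
    (hk₀ : C * radius Δ₀ k₀ ^ 2 ≤ (1 - σ) * δ) :
    ∀ᶠ n in atTop, ∀ z, Feasible V z → IsBV z → l1norm (z - v n) ≤ radius Δ₀ k₀ →
      linRed α (v n) (gradient F (v n)) z < δ := by
  filter_upwards [(hrun.tendsto_objReal_sub hP hFbdd hv₀ hv₀BV).eventually_lt_const
    (mul_pos hP.sigma_pos hδ)] with n hn z hz hzBV hzr
  obtain ⟨hf, hBV⟩ := hrun.feasible_isBV hP hv₀ hv₀BV n le_top
  obtain ⟨k, hk, -, hsol, hwBV, hle⟩ := hrun.step_real hP hv₀ hv₀BV n (ENat.natCast_lt_top n)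
  -- If acceptance happened at radius index `k ≤ k₀`, the accepted candidate is optimal in a region
  -- containing `z`, and `σ` times its prediction is below `σ * δ`. Otherwise the candidate at index
  -- `k₀` was rejected and the quadratic bound applies.
  rcases le_or_gt k k₀ with h | h
  · have h1 := hsol.linRed_le hBV hwBV hz hzBV (hzr.trans (radius_antitone hP.delta_pos h))
    exact h1.trans_lt (lt_of_mul_lt_mul_left (hle.trans_lt hn) hP.sigma_pos.le)
  · have hcand := hrun.candidate n k₀ le_top fun j hj => hk j (hj.trans h)
    have h1 := hP.linRed_lt_of_rejects hf hBV (radius_pos hP.delta_pos k₀).le hcand (hk k₀ h)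
      hz hzBV hzr
    exact lt_of_mul_lt_mul_left (h1.trans_le hk₀) (sub_pos.2 hP.sigma_lt).le

/-- The smallest radius does not exceed the accepted one, so the accepted candidate dominates every
such `z`. No Taylor estimate is needed, and the radius does not depend on `δ`. -/
lemma IsRun.eventually_linRed_lt_of_le_minRadius (hrun : IsRun F V α σ Δ₀ v₀ v w ⊤)
    (hP : ProblemData F α C σ Δ₀) (hFbdd : BddBelow (range F)) (hv₀ : Feasible V v₀)
    (hv₀BV : IsBV v₀) {δ : ℝ} (hδ : 0 < δ) :
    ∀ᶠ n in atTop, ∀ z, Feasible V z → IsBV z → l1norm (z - v n) ≤ minRadius F α σ Δ₀ v w n →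
      linRed α (v n) (gradient F (v n)) z < δ := by
  filter_upwards [(hrun.tendsto_objReal_sub hP hFbdd hv₀ hv₀BV).eventually_lt_const
    (mul_pos hP.sigma_pos hδ)] with n hn z hz hzBV hzr
  obtain ⟨hf, hBV⟩ := hrun.feasible_isBV hP hv₀ hv₀BV n le_top
  obtain ⟨k, hk, -, hsol, hwBV, hle⟩ := hrun.step_real hP hv₀ hv₀BV n (ENat.natCast_lt_top n)
  have hmin : minRadius F α σ Δ₀ v w n ≤ radius Δ₀ k :=
    csInf_le ⟨0, by rintro _ ⟨j, -, rfl⟩; exact (radius_pos hP.delta_pos j).le⟩ ⟨k, hk, rfl⟩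
  have h1 := hsol.linRed_le hBV hwBV hz hzBV (hzr.trans hmin)
  exact h1.trans_lt (lt_of_mul_lt_mul_left (hle.trans_lt hn) hP.sigma_pos.le)

lemma ProblemData.continuous_gradient (hP : ProblemData F α C σ Δ₀) : Continuous (gradient F) :=
  (InnerProductSpace.toDual ℝ (L2 t₀ tf)).symm.continuous.comp
    (hP.contDiff.continuous_fderiv two_ne_zero)

/-- Limits of subsequences of the iterates in an infinite run: feasibility and convergence of the
quantities that enter the linear models. -/
lemma IsRun.accumulation (hrun : IsRun F V α σ Δ₀ v₀ v w ⊤)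
    (hP : ProblemData F α C σ Δ₀) (hFbdd : BddBelow (range F)) (hv₀ : Feasible V v₀)
    (hv₀BV : IsBV v₀) {u : L2 t₀ tf} {ℓ : ℕ → ℕ} (hℓ : StrictMono ℓ)
    (hu : Tendsto (fun i => l1norm (v (ℓ i) - u)) atTop (𝓝 0)) :
    Feasible V u ∧ IsBV u ∧ Tendsto (fun i => tvReal (v (ℓ i))) atTop (𝓝 (tvReal u)) ∧
      ∀ z, Tendsto (fun i => linRed α (v (ℓ i)) (gradient F (v (ℓ i))) z) atTop
        (𝓝 (linRed α u (gradient F u) z)) := by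
  have hfeas : ∀ n, Feasible V (v n) ∧ IsBV (v n) := fun n =>
    hrun.feasible_isBV hP hv₀ hv₀BV n le_top
  have huf : Feasible V u := feasible_of_l1norm (fun i => (hfeas (ℓ i)).1) hu
  have hlim : Tendsto (fun i => v (ℓ i)) atTop (𝓝 u) :=
    tendsto_of_l1norm (fun i => (hfeas (ℓ i)).1) huf hu
  have hg : Tendsto (fun i => gradient F (v (ℓ i))) atTop (𝓝 (gradient F u)) :=
    (hP.continuous_gradient.tendsto u).comp hlim
  have hinner : ∀ z, Tendsto (fun i => (inner ℝ (gradient F (v (ℓ i))) (v (ℓ i) - z) : ℝ)) atTop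
      (𝓝 (inner ℝ (gradient F u) (u - z))) := fun z => hg.inner (hlim.sub_const z)
  have hliminf := TV_le_liminf hu
  obtain ⟨K, hK, hTVK⟩ := hrun.exists_TV_le hP hFbdd hv₀ hv₀BV
  have huBV : IsBV u := hliminf.trans_lt
    ((liminf_le_of_frequently_le' (Frequently.of_forall fun i => hTVK (ℓ i))).trans_lt hK)
  have htv : Tendsto (fun i => tvReal (v (ℓ i))) atTop (𝓝 (tvReal u)) := by
    rw [tendsto_order]
    constructor
    · intro b hb
      rcases lt_or_ge b 0 with hb0 | hb0
      · exact Eventually.of_forall fun i => hb0.trans_le (tvReal_nonneg _)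
      · have h1 : ENNReal.ofReal b < TV u := by
          rw [← ofReal_tvReal huBV]
          exact (ENNReal.ofReal_lt_ofReal_iff_of_nonneg hb0).2 hb
        filter_upwards [eventually_lt_of_lt_liminf (h1.trans_le hliminf)] with i hi
        rw [← ofReal_tvReal (hfeas _).2] at hi
        exact (ENNReal.ofReal_lt_ofReal_iff_of_nonneg hb0).1 hi
    · intro b hb
      -- The competitor `u` bounds `(∇F(v), v - u) + α (TV(v) - TV(u))` by `δ`, and the inner
      -- product is eventually above `-δ`. So `TV(v) - TV(u)` is below `2 * δ / α`, which equals `b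
      -- - tvReal u`.
      have hδ : 0 < α * (b - tvReal u) / 2 := half_pos (mul_pos hP.alpha_pos (sub_pos.2 hb))
      -- Keeping the radius below one allows `radius Δ₀ k₀ ^ 2` to be replaced by `radius Δ₀ k₀`.
      obtain ⟨k₀, hk₀⟩ := exists_radius_lt Δ₀ (ρ := min 1 ((1 - σ) * (α * (b - tvReal u) / 2) / C))
        (lt_min one_pos (div_pos (mul_pos (sub_pos.2 hP.sigma_lt) hδ) hP.const_pos))
      have hr := radius_pos hP.delta_pos k₀
      have hk₀' : C * radius Δ₀ k₀ ^ 2 ≤ (1 - σ) * (α * (b - tvReal u) / 2) := by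
        have h1 := (lt_div_iff₀' hP.const_pos).1 (hk₀.trans_le (min_le_right _ _))
        have h2 : radius Δ₀ k₀ ^ 2 ≤ radius Δ₀ k₀ :=
          pow_le_of_le_one hr.le (hk₀.trans_le (min_le_left _ _)).le two_ne_zero
        exact (mul_le_mul_of_nonneg_left h2 hP.const_pos.le).trans h1.le
      have hi0 := hinner u
      rw [sub_self, inner_zero_right] at hi0
      filter_upwards [hℓ.tendsto_atTop.eventually
          (hrun.eventually_linRed_lt hP hFbdd hv₀ hv₀BV hδ hk₀'),
        hu.eventually_lt_const hr, hi0.eventually_const_lt (neg_lt_zero.2 hδ)] with i h1 h2 h3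
      have h4 := h1 u huf huBV (by rw [l1norm_sub_comm]; exact h2.le)
      rw [linRed] at h4
      nlinarith [hP.alpha_pos]
  exact ⟨huf, huBV, htv, fun z => ((hinner z).add (htv.const_mul α)).sub_const _⟩

/-- A descent competitor at the limit, at a fixed small distance, remains a competitor with nearly
the same prediction for late iterates. This contradicts the smallness of their predictions. -/
lemma IsRun.not_hasLinearDescent_of_accumulation (hrun : IsRun F V α σ Δ₀ v₀ v w ⊤)
    (hP : ProblemData F α C σ Δ₀) (hFbdd : BddBelow (range F)) (hv₀ : Feasible V v₀)
    (hv₀BV : IsBV v₀) {u : L2 t₀ tf} {ℓ : ℕ → ℕ} (hℓ : StrictMono ℓ)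
    (hu : Tendsto (fun i => l1norm (v (ℓ i) - u)) atTop (𝓝 0)) :
    ¬ HasLinearDescent V u (gradient F u) := fun hd => by
  obtain ⟨huf, huBV, -, hred⟩ := hrun.accumulation hP hFbdd hv₀ hv₀BV hℓ hu
  obtain ⟨ε, hε, ρ₀, hρ₀, hd⟩ := hd.exists_linRed_ge huBV α
  have hσ : 0 < 1 - σ := sub_pos.2 hP.sigma_lt
  obtain ⟨k, hk⟩ := exists_radius_lt Δ₀
    (lt_min hρ₀ (div_pos (mul_pos hσ (div_pos hε four_pos)) hP.const_pos))
  have hr := radius_pos hP.delta_pos k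
  -- Half of the radius goes to the competitor and half to the distance between `u` and the iterate.
  -- The prediction `ε * r / 2` leaves room above the threshold `ε / 4 * r`.
  obtain ⟨z, hz, hzBV, hl, hi⟩ := hd _ (half_pos hr)
    ((half_lt_self hr).trans (hk.trans_le (min_le_left _ _)))
  have hδ : 0 < ε / 4 * radius Δ₀ k := by positivity
  have hCk : C * radius Δ₀ k ^ 2 ≤ (1 - σ) * (ε / 4 * radius Δ₀ k) := by
    have h1 := (lt_div_iff₀' hP.const_pos).1 (hk.trans_le (min_le_right _ _))
    have h2 := mul_le_mul_of_nonneg_right h1.le hr.le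
    linarith
  obtain ⟨i, h1, h2, h3⟩ := ((hℓ.tendsto_atTop.eventually
    (hrun.eventually_linRed_lt hP hFbdd hv₀ hv₀BV hδ hCk)).and
    ((hu.eventually_lt_const (half_pos hr)).and ((hred z).eventually_const_lt
      (show ε / 4 * radius Δ₀ k < _ by linarith)))).exists
  refine absurd h3 (h1 z hz hzBV ?_).not_gt
  have := l1norm_sub_le z u (v (ℓ i))
  rw [l1norm_sub_comm u] at this
  linarith

/-- A competitor with positive prediction at `u` would, by convergence of the linear models, keep at
least half of it at late iterates. Halving `r` again leaves room for the distance to the iterate. -/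
lemma IsRun.solvesTR_of_accumulation (hrun : IsRun F V α σ Δ₀ v₀ v w ⊤)
    (hP : ProblemData F α C σ Δ₀) (hFbdd : BddBelow (range F)) (hv₀ : Feasible V v₀)
    (hv₀BV : IsBV v₀) {u : L2 t₀ tf} {ℓ : ℕ → ℕ} (hℓ : StrictMono ℓ)
    (hu : Tendsto (fun i => l1norm (v (ℓ i) - u)) atTop (𝓝 0)) {r : ℝ} (hr : 0 < r)
    (hmin : ∀ᶠ i in atTop, r ≤ minRadius F α σ Δ₀ v w (ℓ i)) :
    SolvesTR V α u (gradient F u) (r / 2) u := by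
  obtain ⟨huf, huBV, -, hred⟩ := hrun.accumulation hP hFbdd hv₀ hv₀BV hℓ hu
  refine solvesTR_self hP.alpha_pos huf huBV (half_pos hr).le fun z hz hzBV hl =>
    not_lt.1 fun hpos => ?_
  obtain ⟨i, h1, h2, h3, h4⟩ := ((hℓ.tendsto_atTop.eventually
    (hrun.eventually_linRed_lt_of_le_minRadius hP hFbdd hv₀ hv₀BV (half_pos hpos))).and
    ((hu.eventually_lt_const (half_pos hr)).and (hmin.and ((hred z).eventually_const_lt
      (half_lt_self hpos))))).exists
  refine absurd h4 (h1 z hz hzBV ?_).not_gt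
  have := l1norm_sub_le z u (v (ℓ i))
  rw [l1norm_sub_comm u] at this
  linarith

theorem IsRun.outcomeInfinite (hrun : IsRun F V α σ Δ₀ v₀ v w ⊤)
    (hP : ProblemData F α C σ Δ₀) (hΩ : t₀ < tf) (hFbdd : BddBelow (range F))
    (hv₀ : Feasible V v₀) (hv₀BV : IsBV v₀) : OutcomeInfinite F V α σ Δ₀ v w ⊤ := by
  have hfeas : ∀ n, Feasible V (v n) ∧ IsBV (v n) := fun n =>
    hrun.feasible_isBV hP hv₀ hv₀BV n le_top
  refine ⟨rfl, ?_, fun u ℓ hℓ hu => ?_, fun ℓ hℓ hlim u κ hκ hu => ?_⟩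
  · obtain ⟨K, hK, hTVK⟩ := hrun.exists_TV_le hP hFbdd hv₀ hv₀BV
    exact exists_weakStarTendsto hΩ (fun n => (hfeas n).1) hK hTVK
  · obtain ⟨huf, huBV, htv, -⟩ := hrun.accumulation hP hFbdd hv₀ hv₀BV hℓ hu.1
    refine ⟨huf, lStationary_of_not_hasLinearDescent hΩ huf huBV
      (hrun.not_hasLinearDescent_of_accumulation hP hFbdd hv₀ hv₀BV hℓ hu.1), huBV, hu.1, ?_⟩
    rw [← ofReal_tvReal huBV]
    exact (ENNReal.tendsto_ofReal htv).congr fun i => ofReal_tvReal (hfeas (ℓ i)).2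
  · obtain ⟨r, hr, hrlim⟩ := exists_between hlim
    -- A real `liminf` is informative only for sequences bounded below; here radii are nonnegative.
    have hbdd : IsBoundedUnder (· ≥ ·) atTop fun i => minRadius F α σ Δ₀ v w (ℓ i) :=
      isBoundedUnder_of ⟨0, fun i => Real.sInf_nonneg (by
        rintro _ ⟨j, -, rfl⟩; exact (radius_pos hP.delta_pos j).le)⟩
    have hmin := eventually_lt_of_lt_liminf hrlim hbdd
    exact ⟨r / 2, half_pos hr, hrun.solvesTR_of_accumulation hP hFbdd hv₀ hv₀BV (hℓ.comp hκ) hu.1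
      hr ((hκ.tendsto_atTop.eventually hmin).mono fun i hi => hi.le)⟩

end Run

end SLIP

/-! ### Assembly of the three outcomes -/

theorem theorem4p13 (t₀ tf : ℝ) (hΩ : t₀ < tf)
    (V : Finset ℤ) (α : ℝ) (hα : 0 < α)
    (F : SLIP.L2 t₀ tf → ℝ)
    (hFlsc : LowerSemicontinuous F) (hFbdd : BddBelow (Set.range F))
    (hFdiff : ContDiff ℝ 2 F)
    (hFhess : ∃ C : ℝ, 0 < C ∧ ∀ ξ u w : SLIP.L2 t₀ tf,
      |fderiv ℝ (fderiv ℝ F) ξ u w| ≤ C * SLIP.l1norm u * SLIP.l1norm w)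
    (σ : ℝ) (hσ₀ : 0 < σ) (hσ₁ : σ < 1) (Δ₀ : ℝ) (hΔ₀ : 0 < Δ₀)
    (v₀ : SLIP.L2 t₀ tf) (hv₀ : SLIP.Feasible V v₀) (hv₀BV : SLIP.IsBV v₀)
    (v : ℕ → SLIP.L2 t₀ tf) (w : ℕ → ℕ → SLIP.L2 t₀ tf) (N : ℕ∞)
    (hrun : SLIP.IsRun F V α σ Δ₀ v₀ v w N) :
    (∀ n : ℕ, (n : ℕ∞) ≤ N → SLIP.Feasible V (v n)) ∧
    (∀ n : ℕ, (n : ℕ∞) < N → SLIP.J F α (v (n + 1)) < SLIP.J F α (v n)) ∧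
    (SLIP.OutcomeSolved F V α v N ∨ SLIP.OutcomeStalled F V α σ v w N ∨
      SLIP.OutcomeInfinite F V α σ Δ₀ v w N) ∧
    ¬ (SLIP.OutcomeSolved F V α v N ∧ SLIP.OutcomeStalled F V α σ v w N) ∧
    ¬ (SLIP.OutcomeSolved F V α v N ∧ SLIP.OutcomeInfinite F V α σ Δ₀ v w N) ∧
    ¬ (SLIP.OutcomeStalled F V α σ v w N ∧ SLIP.OutcomeInfinite F V α σ Δ₀ v w N) ∧
    (SLIP.OutcomeSolved F V α v N ↔ ∃ n : ℕ, N = n ∧ SLIP.TerminatesAt F α σ v w n) := by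
  obtain ⟨C, hC, hhess⟩ := hFhess
  have hP : SLIP.ProblemData F α C σ Δ₀ := ⟨hα, hFdiff, hhess, hC, hσ₀, hσ₁, hΔ₀⟩
  have hfeas := hrun.feasible_isBV hP hv₀ hv₀BV
  have hnot : ¬ (SLIP.OutcomeSolved F V α v N ∧ SLIP.OutcomeStalled F V α σ v w N) := by
    rintro ⟨⟨n, hn, ⟨Δ, hΔ, hsol⟩, -⟩, m, hm, hinf, -⟩
    obtain rfl : n = m := by exact_mod_cast hn.symm.trans hm
    exact hrun.not_innerLoopInfinite_of_solvesTR hP hv₀ hv₀BV hn.symm hΔ hsol hinf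
  refine ⟨fun n hn => (hfeas n hn).1, fun n hn => ?_, ?_, hnot, ?_, ?_, ?_, ?_⟩
  · rw [SLIP.J_eq (hfeas n hn.le).2, SLIP.J_eq (hfeas (n + 1) (Order.add_one_le_of_lt hn)).2,
      EReal.coe_lt_coe_iff]
    exact hrun.objReal_lt hP hv₀ hv₀BV n hn
  · induction N using ENat.recTopCoe with
    | top => exact Or.inr (Or.inr (hrun.outcomeInfinite hP hΩ hFbdd hv₀ hv₀BV))
    | coe n =>
      rcases hrun.terminatesAt_or_innerLoopInfinite rfl with h | h
      · exact Or.inl (hrun.solves_of_terminatesAt hP hΩ hv₀ hv₀BV rfl h)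
      · exact Or.inr (Or.inl ⟨n, rfl, h,
          hrun.lStationary_of_innerLoopInfinite hP hΩ hv₀ hv₀BV rfl h⟩)
  · rintro ⟨⟨n, hn, -⟩, htop, -⟩
    exact ENat.natCast_ne_top n (hn.symm.trans htop)
  · rintro ⟨⟨n, hn, -⟩, htop, -⟩
    exact ENat.natCast_ne_top n (hn.symm.trans htop)
  -- Being solved rules out an infinite inner loop, and termination is the only alternative at a
  -- final iterate.
  · rintro ⟨n, hn, ⟨Δ, hΔ, hsol⟩, -⟩
    exact ⟨n, hn, (hrun.terminatesAt_or_innerLoopInfinite hn.symm).resolve_right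
      (hrun.not_innerLoopInfinite_of_solvesTR hP hv₀ hv₀BV hn.symm hΔ hsol)⟩
  · rintro ⟨n, hn, hterm⟩
    exact hrun.solves_of_terminatesAt hP hΩ hv₀ hv₀BV hn.symm hterm
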